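/- Let $(K,v)$ be a field with a Krull valuation $v$ that is Henselian (i.e. $v$ extends, uniquely up to equivalence, to a valuation on each algebraic extension of $K$) and discrete (i.e. its value group is infinite cyclic), and suppose that its residue field $\widehat K$ is finite. Let $K_{\rm ab}$ be the maximal abelian extension of $K$ in a separable closure $K_{\rm sep}$ of $K$. Call a finite extension $L/K$ tamely ramified if the ramification index $e(L/K)$, i.e. the index of the value group of $K$ in the value group of $L$ with respect to the extension of $v$ to $L$, is not divisible by the characteristic of $\widehat K$. Let $T$ be the compositum of the tamely ramified finite extensions of $K$ in $K_{\rm ab}$. Then $T/K$ is a Galois extension, and its Galois group $\mathcal G(T/K)$ (with the Krull topology) is isomorphic, as a topological group, to $\mathcal G_{\widehat K}\times\widehat K^{*}$, where $\mathcal G_{\widehat K}=\mathcal G(\widehat K_{\rm sep}/\widehat K)$ is the absolute Galois group of $\widehat K$ and the multiplicative group $\widehat K^{*}$ is discrete. Moreover, the valuation $v_T$ of $T$ extending $v$ is discrete. -/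

import Mathlib

universe u v

namespace HDVField

/-- The value group `v(K)` of a Krull valuation `v` of a field `K`, in multiplicative notation:
the subgroup of the units of the codomain formed by the values of the nonzero elements. -/
noncomputable def valueGroup {K : Type*} [Field K] {Γ : Type*} [LinearOrderedCommGroupWithZero Γ]
    (v : Valuation K Γ) : Subgroup Γˣ :=
  MonoidWithZeroHom.valueGroup (MonoidWithZeroHom.ofClass v)

/-- A valuation is discrete if its value group is infinite cyclic. -/
def IsDiscrete {K : Type*} [Field K] {Γ : Type*} [LinearOrderedCommGroupWithZero Γ]
    (v : Valuation K Γ) : Prop :=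
  IsCyclic (valueGroup v) ∧ Infinite (valueGroup v)

/-- The residue field of a valuation. -/
abbrev Residue {K : Type*} [Field K] {Γ : Type*} [LinearOrderedCommGroupWithZero Γ]
    (v : Valuation K Γ) : Type _ :=
  IsLocalRing.ResidueField v.valuationSubring

/-- A valuation `v` of `K` is Henselian if it extends uniquely, up to equivalence, to a valuation
on each algebraic extension `L` of `K`. Up to isomorphism every algebraic extension of `K`, and up
to equivalence every valuation of it, lives in the universe of `K`. -/
def IsHenselian {K : Type u} [Field K] {Γ₀ : Type v} [LinearOrderedCommGroupWithZero Γ₀]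
    (v : Valuation K Γ₀) : Prop :=
  ∀ (L : Type u) [Field L] [Algebra K L] [Algebra.IsAlgebraic K L],
    (∃ (Γ : Type u) (_ : LinearOrderedCommGroupWithZero Γ) (w : Valuation L Γ),
      v.HasExtension w) ∧
    ∀ (Γ₁ Γ₂ : Type u) [LinearOrderedCommGroupWithZero Γ₁] [LinearOrderedCommGroupWithZero Γ₂]
      (w₁ : Valuation L Γ₁) (w₂ : Valuation L Γ₂),
      v.HasExtension w₁ → v.HasExtension w₂ → w₁.IsEquiv w₂

/-- The ramification index of `L/K` with respect to a valuation `w` of `L`: the index in `w(L)` of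
the value group `w(K)` of the restriction of `w` to `K`. -/
noncomputable def ramificationIndex (K : Type*) {L : Type*} [Field K] [Field L] [Algebra K L]
    {Γ : Type*} [LinearOrderedCommGroupWithZero Γ] (w : Valuation L Γ) : ℕ :=
  (valueGroup (w.comap (algebraMap K L))).relIndex (valueGroup w)

/-- An extension `L/K` (meant: finite, with `v` Henselian, so that the extension `w` of `v` to `L`
exists and is unique up to equivalence) is tamely ramified if its ramification index is not
divisible by the characteristic of the residue field of `(K, v)`. -/
def IsTamelyRamified {K : Type u} [Field K] {Γ₀ : Type v} [LinearOrderedCommGroupWithZero Γ₀]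
    (v : Valuation K Γ₀) (L : Type u) [Field L] [Algebra K L] : Prop :=
  ∀ (Γ : Type u) [LinearOrderedCommGroupWithZero Γ] (w : Valuation L Γ),
    v.HasExtension w → ¬ ringChar (Residue v) ∣ ramificationIndex K w

/-- The maximal abelian extension `K_ab` of `K` in its separable closure: the compositum of all
abelian Galois extensions of `K` in the separable closure. -/
noncomputable def maxAbelianExtension (K : Type u) [Field K] :
    IntermediateField K (SeparableClosure K) :=
  sSup {L | IsAbelianGalois K L}

/-- The compositum of the tamely ramified finite extensions of `K` in `K_ab`. -/
noncomputable def tameAbelianCompositum {K : Type u} [Field K] {Γ₀ : Type v}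
    [LinearOrderedCommGroupWithZero Γ₀] (v : Valuation K Γ₀) :
    IntermediateField K (SeparableClosure K) :=
  sSup {L | L ≤ maxAbelianExtension K ∧ FiniteDimensional K L ∧ IsTamelyRamified v L}

end HDVField

namespace HDVField

/-! ### Residues, inertia, and values coming from the base -/

section Basic

variable {K L Γ : Type*} [Field K] [Field L] [Algebra K L] [LinearOrderedCommGroupWithZero Γ]

/-! Write q = p ^ f for the order of the residue field k, π for a uniformizer of K, and l for a root
of X ^ (q - 1) - π. The field T contains all roots of unity of order p ^ n - 1, which generate
unramified extensions, and it contains l: since K contains the (q - 1)-th roots of unity, K(l)/K is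
a totally ramified Kummer extension, cyclic of order q - 1. The isomorphism sends σ to its action on
the residue field of T, a separable closure of k, paired with its restriction to K(l).

Two facts bound T from above. Wild inertia vanishes in a finite tame abelian extension
(`IsLocalBase.wildInertia_eq_bot`). A Frobenius lift commutes with inertia, so the tame characters x
↦ σ x / x have residues in kˣ; hence inertia is killed by q - 1
(`IsLocalBase.pow_eq_one_of_mem_inertia`). By a trace argument (`exists_val_eq`), w x ^ (q - 1) is
then a value of K for every nonzero x in T, so the value of l generates the value group of T, which
is therefore discrete.

Injectivity: an inertia element fixing l moves each a = l ^ j * u, with u a unit, by less than its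
value, so it is wild on every finite tame piece, hence trivial. Surjectivity: K(l) has no new
residues, so residue automorphisms lift to automorphisms fixing l. -/

theorem residue_eq_iff {w : Valuation L Γ} (x y : w.valuationSubring) :
    IsLocalRing.residue _ x = IsLocalRing.residue _ y ↔ w ((x : L) - y) < 1 := by
  rw [← sub_eq_zero, ← map_sub, IsLocalRing.residue_eq_zero_iff, Valuation.mem_maximalIdeal_iff]
  rfl

theorem residue_eq_zero_iff {w : Valuation L Γ} (x : w.valuationSubring) :
    IsLocalRing.residue _ x = 0 ↔ w (x : L) < 1 := by
  rw [IsLocalRing.residue_eq_zero_iff, Valuation.mem_maximalIdeal_iff]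

theorem val_natCast_le_one (w : Valuation L Γ) (n : ℕ) : w (n : L) ≤ 1 :=
  natCast_mem w.valuationSubring n

theorem val_natCast_eq_one {w : Valuation L Γ} {p : ℕ} (hp : p.Prime) (hw : w (p : L) < 1) {n : ℕ}
    (hn : ¬ p ∣ n) : w (n : L) = 1 := by
  refine le_antisymm (val_natCast_le_one w n) (not_lt.1 fun h ↦ ?_)
  have hc : IsCoprime (p : ℤ) (n : ℤ) :=
    Nat.isCoprime_iff_coprime.2 ((Nat.Prime.coprime_iff_not_dvd hp).2 hn)
  obtain ⟨a, b, hab⟩ := hc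
  have h1 : (a : L) * p + b * n = 1 := by exact_mod_cast congrArg (Int.cast : ℤ → L) hab
  have hint (z : ℤ) : w (z : L) ≤ 1 := intCast_mem w.valuationSubring z
  have h2 : w ((a : L) * p + b * n) < 1 := by
    refine w.map_add_lt ?_ ?_ <;> rw [map_mul]
    · exact mul_lt_one_of_nonneg_of_lt_one_right (hint a) zero_le hw
    · exact mul_lt_one_of_nonneg_of_lt_one_right (hint b) zero_le h
  rw [h1, map_one] at h2
  exact lt_irrefl _ h2

/-- A root of unity of order prime to the residue characteristic which is congruent to `1`
equals `1`. -/
theorem eq_zero_of_one_add_pow_eq_one {w : Valuation L Γ} {m : ℕ} (hm : w (m : L) = 1) {t : L}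
    (ht : w t < 1) (h : (1 + t) ^ m = 1) : t = 0 := by
  have h1 : (∑ i ∈ Finset.range m, (1 + t) ^ i) * t = 0 := by
    have := geom_sum_mul (1 + t) m
    rwa [h, sub_self, add_sub_cancel_left] at this
  -- If the geometric sum vanished, so would its residue, which is m; but m is a unit.
  refine (mul_eq_zero.1 h1).resolve_left fun h0 ↦ ?_
  let y : w.valuationSubring := ⟨t, ht.le⟩
  have hy : IsLocalRing.residue _ y = 0 := (residue_eq_zero_iff y).2 ht
  have h2 : ∑ i ∈ Finset.range m, (1 + y) ^ i = 0 := Subtype.ext (by push_cast; exact h0)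
  have h3 := congrArg (IsLocalRing.residue _) h2
  simp only [map_sum, map_pow, map_add, map_one, hy, add_zero, one_pow, Finset.sum_const,
    Finset.card_range, nsmul_eq_mul, mul_one, map_zero] at h3
  rw [← map_natCast (IsLocalRing.residue _), residue_eq_zero_iff] at h3
  push_cast at h3
  exact h3.ne hm

/-- The inertia group of a valuation `w`. -/
def inertia (K : Type*) [Field K] [Algebra K L] (w : Valuation L Γ) : Subgroup Gal(L/K) where
  carrier := {σ | (∀ x, w (σ x) = w x) ∧ ∀ x, w x ≤ 1 → w (σ x - x) < 1}
  one_mem' := by simp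
  mul_mem' {σ τ} hσ hτ := by
    refine ⟨fun x ↦ by rw [AlgEquiv.mul_apply, hσ.1, hτ.1], fun x hx ↦ ?_⟩
    rw [AlgEquiv.mul_apply, ← sub_add_sub_cancel _ (τ x)]
    exact w.map_add_lt (hσ.2 _ (by rwa [hτ.1])) (hτ.2 x hx)
  inv_mem' {σ} hσ := by
    have h1 (x) : w (σ⁻¹ x) = w x := by
      rw [← hσ.1, ← AlgEquiv.mul_apply, mul_inv_cancel, AlgEquiv.one_apply]
    refine ⟨h1, fun x hx ↦ ?_⟩
    have := hσ.2 (σ⁻¹ x) (by rwa [h1])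
    rwa [← AlgEquiv.mul_apply, mul_inv_cancel, AlgEquiv.one_apply, w.map_sub_swap] at this

/-- The hypotheses under which we work: `w` is a Galois invariant valuation of `L`, whose restriction
to `K` is discrete with uniformizer `π` and has a residue field of `p ^ f` elements. -/
structure IsLocalBase (w : Valuation L Γ) (π : K) (p f : ℕ) : Prop where
  prime : p.Prime
  f_ne : f ≠ 0
  val_p : w (p : L) < 1
  pow_q : ∀ x : K, w (algebraMap K L x) ≤ 1 → w (algebraMap K L x ^ p ^ f - algebraMap K L x) < 1
  pi_ne : π ≠ 0
  pi_lt : w (algebraMap K L π) < 1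
  gen : ∀ x : K, x ≠ 0 → ∃ j : ℤ, w (algebraMap K L x) = w (algebraMap K L π) ^ j
  inv : ∀ (σ : Gal(L/K)) (x : L), w (σ x) = w x

/-- The action of a Galois invariant automorphism on the valuation ring. -/
def integerMap (w : Valuation L Γ) (hw : ∀ (σ : Gal(L/K)) (x : L), w (σ x) = w x) (σ : Gal(L/K)) :
    w.valuationSubring →+* w.valuationSubring where
  toFun x := ⟨σ x, (hw σ x).trans_le x.2⟩
  map_one' := Subtype.ext (map_one σ)
  map_mul' x y := Subtype.ext (map_mul σ (x : L) y)
  map_zero' := Subtype.ext (map_zero σ)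
  map_add' x y := Subtype.ext (map_add σ (x : L) y)

/-- If the order of the inertia group is prime to `p` and the tame characters of `y` vanish,
then the value of `y` is the value of an element of `K`. -/
theorem exists_val_eq {w : Valuation L Γ} [FiniteDimensional K L] [IsGalois K L]
    (hw : ∀ (σ : Gal(L/K)) (x : L), w (σ x) = w x)
    (hI : w (Nat.card (inertia K w) : L) = 1) {y : L} (hy : y ≠ 0)
    (hy' : ∀ σ ∈ inertia K w, w (σ y - y) < w y) :
    ∃ z : K, w (algebraMap K L z) = w y := by
  classical
  let χ (τ : Gal(L/K)) : w.valuationSubring →* IsLocalRing.ResidueField w.valuationSubring :=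
    ((IsLocalRing.residue _).comp (integerMap w hw τ)).toMonoidHom
  have hwy : w y ≠ 0 := (w.ne_zero_iff).2 hy
  let u (τ : Gal(L/K)) : w.valuationSubring :=
    ⟨τ y / y, (show w (τ y / y) ≤ 1 by rw [map_div₀, hw, div_self hwy])⟩
  have hχ (τ : Gal(L/K)) : χ τ = χ 1 ↔ τ ∈ inertia K w := by
    constructor
    · intro h
      refine ⟨hw τ, fun x hx ↦ ?_⟩
      exact (residue_eq_iff _ _).1 (DFunLike.congr_fun h ⟨x, hx⟩)
    · intro h
      ext x
      exact (residue_eq_iff _ _).2 (h.2 x x.2)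
  have hu (τ) (hτ : τ ∈ inertia K w) : IsLocalRing.residue _ (u τ) = 1 := by
    rw [← map_one (IsLocalRing.residue w.valuationSubring), residue_eq_iff]
    have : ((u τ : L) - (1 : w.valuationSubring)) = (τ y - y) / y := by
      simp only [u, OneMemClass.coe_one, sub_div, div_self hy]
    rw [this, map_div₀]
    exact (div_lt_one₀ (zero_lt_iff.2 hwy)).2 (hy' τ hτ)
  -- Dedekind independence of the distinct characters among the `χ τ`. Those equal to `χ 1` come
  -- from inertia, where `u τ` has residue 1, so the coefficient of `χ 1` is the order of inertia,
  -- nonzero in the residue field.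
  have hex : ∃ b : w.valuationSubring, ∑ τ : Gal(L/K), IsLocalRing.residue _ (u τ) * χ τ b ≠ 0 := by
    by_contra! hall
    have hlin := linearIndependent_iff'.1
      (linearIndependent_monoidHom w.valuationSubring (IsLocalRing.ResidueField w.valuationSubring))
      (Finset.univ.image χ)
      (fun ψ ↦ ∑ τ with χ τ = ψ, IsLocalRing.residue _ (u τ)) (by
        ext b
        simp only [Finset.sum_apply, Pi.smul_apply, smul_eq_mul, Pi.zero_apply]
        rw [← hall b, ← Finset.sum_fiberwise_of_maps_to (g := χ) (t := Finset.univ.image χ)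
          (fun x _ ↦ Finset.mem_image_of_mem _ (Finset.mem_univ x))]
        refine Finset.sum_congr rfl fun ψ _ ↦ ?_
        rw [Finset.sum_mul]
        refine Finset.sum_congr rfl fun τ hτ ↦ ?_
        rw [(Finset.mem_filter.1 hτ).2])
      (χ 1) (Finset.mem_image_of_mem _ (Finset.mem_univ _))
    rw [Finset.sum_congr rfl (g := fun _ ↦ 1)
      (fun τ hτ ↦ hu τ ((hχ τ).1 (Finset.mem_filter.1 hτ).2)), Finset.sum_const, nsmul_eq_mul,
      mul_one, ← map_natCast (IsLocalRing.residue _), residue_eq_zero_iff] at hlin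
    have hc : (Finset.univ.filter fun τ ↦ χ τ = χ 1).card = Nat.card (inertia K w) :=
      (Nat.subtype_card _ fun τ ↦ by simp [hχ]).symm
    rw [hc] at hlin
    push_cast at hlin
    exact hlin.ne hI
  obtain ⟨b, hb⟩ := hex
  -- This trace is y * s, where s has the nonzero residue just found and is therefore a unit.
  refine ⟨Algebra.trace K L (y * b), ?_⟩
  rw [trace_eq_sum_automorphisms]
  let s : w.valuationSubring := ∑ τ : Gal(L/K), u τ * integerMap w hw τ b
  have hs : w (s : L) = 1 := by
    refine le_antisymm s.2 (not_lt.1 fun h ↦ hb ?_)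
    rw [← residue_eq_zero_iff] at h
    simp only [s, map_sum, map_mul] at h
    exact h
  have : ∑ τ : Gal(L/K), τ (y * b) = y * s := by
    simp only [s, AddSubmonoidClass.coe_finsetSum, Finset.mul_sum]
    refine Finset.sum_congr rfl fun τ _ ↦ ?_
    simp only [u, integerMap, MulMemClass.coe_mul, RingHom.coe_mk, MonoidHom.coe_mk, OneHom.coe_mk,
      map_mul]
    field_simp
  rw [this, map_mul, hs, mul_one]

end Basic
-- Wild inertia and defectlessness
section Wild

variable {K L Γ : Type*} [Field K] [Field L] [Algebra K L] [LinearOrderedCommGroupWithZero Γ]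

theorem mem_valueGroup_iff {w : Valuation L Γ} {g : Γˣ} :
    g ∈ valueGroup w ↔ ∃ x : L, x ≠ 0 ∧ w x = g := by
  rw [valueGroup, MonoidWithZeroHom.mem_valueGroup_iff_of_comm]
  constructor
  · rintro ⟨a, ha, x, hx⟩
    simp only [MonoidWithZeroHom.coe_ofClass] at ha hx
    have h : w (x / a) = g := by rw [map_div₀, ← hx, mul_div_cancel_left₀ _ ha]
    refine ⟨x / a, ?_, h⟩
    rw [← w.ne_zero_iff, h]
    exact g.ne_zero
  · rintro ⟨x, hx, h⟩
    exact ⟨1, by simp, x, by simp [h]⟩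

/-- Lagrange in the quotient of the value groups. For infinite index `ramificationIndex` is 0 and
the claim is trivial. -/
theorem exists_val_pow_ramificationIndex (w : Valuation L Γ) {x : L} (hx : x ≠ 0) :
    ∃ z : K, z ≠ 0 ∧ w (algebraMap K L z) = w x ^ ramificationIndex K w := by
  let g : valueGroup w := ⟨Units.mk0 (w x) ((w.ne_zero_iff).2 hx), mem_valueGroup_iff.2 ⟨x, hx, rfl⟩⟩
  have h := Subgroup.pow_index_mem ((valueGroup (w.comap (algebraMap K L))).subgroupOf (valueGroup w)) g
  rw [Subgroup.mem_subgroupOf] at h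
  obtain ⟨z, hz, h⟩ := mem_valueGroup_iff.1 h
  exact ⟨z, hz, h⟩

/-- The wild inertia group of a valuation `w`. -/
def wildInertia (K : Type*) [Field K] [Algebra K L] (w : Valuation L Γ) : Subgroup Gal(L/K) where
  carrier := {σ | (∀ x, w (σ x) = w x) ∧ ∀ x, x ≠ 0 → w (σ x - x) < w x}
  one_mem' := ⟨fun _ ↦ rfl, fun x hx ↦ by simpa [zero_lt_iff] using hx⟩
  mul_mem' {σ τ} hσ hτ := by
    refine ⟨fun x ↦ by rw [AlgEquiv.mul_apply, hσ.1, hτ.1], fun x hx ↦ ?_⟩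
    rw [AlgEquiv.mul_apply, ← sub_add_sub_cancel _ (τ x)]
    exact w.map_add_lt ((hσ.2 _ (by simpa using hx)).trans_eq (hτ.1 x)) (hτ.2 x hx)
  inv_mem' {σ} hσ := by
    have h1 (x) : w (σ⁻¹ x) = w x := by
      rw [← hσ.1, ← AlgEquiv.mul_apply, mul_inv_cancel, AlgEquiv.one_apply]
    refine ⟨h1, fun x hx ↦ ?_⟩
    have := hσ.2 (σ⁻¹ x) (by simpa using hx)
    rwa [← AlgEquiv.mul_apply, mul_inv_cancel, AlgEquiv.one_apply, w.map_sub_swap, h1] at this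

/-- With y = τ x - x, the conjugates of y under powers of τ telescope to 0, while each agrees with y
to leading order. Hence m * y is smaller than y, impossible for a unit m unless y = 0. -/
theorem eq_one_of_mem_wildInertia_of_pow {w : Valuation L Γ} {τ : Gal(L/K)}
    (hτ : τ ∈ wildInertia K w) {m : ℕ} (hm : w (m : L) = 1) (h : τ ^ m = 1) : τ = 1 := by
  ext x
  rw [AlgEquiv.one_apply, ← sub_eq_zero]
  by_contra hy
  set y := τ x - x with hy_def
  have h1 : ∑ i ∈ Finset.range m, (τ ^ i) y = 0 := by
    have : ∀ i, (τ ^ i) y = (τ ^ (i + 1)) x - (τ ^ i) x := fun i ↦ by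
      rw [hy_def, map_sub, pow_succ, AlgEquiv.mul_apply]
    simp only [this]
    rw [Finset.sum_range_sub (fun i ↦ (τ ^ i) x), h, pow_zero, sub_self]
  have h2 : (m : L) * y = - ∑ i ∈ Finset.range m, ((τ ^ i) y - y) := by
    rw [Finset.sum_sub_distrib, h1, Finset.sum_const, Finset.card_range, nsmul_eq_mul]; ring
  have h3 : w ((m : L) * y) < w y := by
    rw [h2, Valuation.map_neg]
    exact w.map_sum_lt ((w.ne_zero_iff).2 hy) fun i _ ↦ (pow_mem hτ i).2 y hy
  rw [map_mul, hm, one_mul] at h3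
  exact lt_irrefl _ h3

theorem exists_pow_prime_pow_eq_one {w : Valuation L Γ} [FiniteDimensional K L] {p : ℕ}
    (hp : p.Prime) (hw : w (p : L) < 1) {τ : Gal(L/K)} (hτ : τ ∈ wildInertia K w) :
    ∃ a : ℕ, τ ^ p ^ a = 1 := by
  obtain ⟨a, m, hm, h⟩ := Nat.exists_eq_pow_mul_and_not_dvd (orderOf_pos τ).ne' p hp.ne_one
  refine ⟨a, eq_one_of_mem_wildInertia_of_pow (pow_mem hτ _) (val_natCast_eq_one hp hw hm) ?_⟩
  rw [← pow_mul, ← h, pow_orderOf_eq_one]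

theorem IsLocalBase.charP_residueField {w : Valuation L Γ} {π : K} {p f : ℕ}
    (H : IsLocalBase w π p f) : CharP (IsLocalRing.ResidueField w.valuationSubring) p := by
  rw [CharP.charP_iff_prime_eq_zero H.prime, ← map_natCast (IsLocalRing.residue _),
    residue_eq_zero_iff]
  exact_mod_cast H.val_p

/-- The residue field is algebraic over the residue field of the base, in an explicit form. -/
theorem IsLocalBase.exists_pow_eq [Algebra.IsAlgebraic K L] {w : Valuation L Γ} {π : K} {p f : ℕ}
    (H : IsLocalBase w π p f) (t : IsLocalRing.ResidueField w.valuationSubring) :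
    ∃ M : ℕ, 0 < M ∧ t ^ (p ^ f) ^ M = t := by
  classical
  obtain ⟨x, rfl⟩ := IsLocalRing.residue_surjective t
  have := H.charP_residueField
  have := Fact.mk H.prime
  set t := IsLocalRing.residue _ x
  have hx : IsIntegral K (x : L) := Algebra.IsIntegral.isIntegral _
  set P := minpoly K (x : L)
  have hP : P ≠ 0 := minpoly.ne_zero hx
  -- Dividing the minimal polynomial by a coefficient of largest value makes it integral with one
  -- coefficient 1, so its reduction Q is nonzero.
  obtain ⟨i₀, hi₀, hmax⟩ := P.support.exists_max_image (fun i ↦ w (algebraMap K L (P.coeff i)))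
    (Polynomial.nonempty_support_iff.2 hP)
  set c := P.coeff i₀
  have hc : c ≠ 0 := Polynomial.mem_support_iff.1 hi₀
  have hwc : 0 < w (algebraMap K L c) := by simpa [zero_lt_iff] using hc
  have hle (i) : w (algebraMap K L (P.coeff i / c)) ≤ 1 := by
    by_cases hi : P.coeff i = 0
    · simp [hi]
    rw [map_div₀, map_div₀]
    exact (div_le_one₀ hwc).2 (hmax i (Polynomial.mem_support_iff.2 hi))
  let a (i : ℕ) : w.valuationSubring := ⟨_, hle i⟩
  let Q : Polynomial (IsLocalRing.ResidueField w.valuationSubring) :=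
    ∑ i ∈ P.support, Polynomial.monomial i (IsLocalRing.residue _ (a i))
  have hQ : Q ≠ 0 := by
    intro h0
    have h1 := congrArg (Polynomial.coeff · i₀) h0
    simp only [Q, Polynomial.finsetSum_coeff, Polynomial.coeff_monomial, Finset.sum_ite_eq', hi₀,
      if_true, Polynomial.coeff_zero, residue_eq_zero_iff] at h1
    have : (a i₀ : L) = 1 := by simp only [a]; rw [div_self hc, map_one]
    rw [this, map_one] at h1
    exact lt_irrefl _ h1
  have hroot : Q.eval t = 0 := by
    have h1 : ∑ i ∈ P.support, a i * x ^ i = 0 := by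
      apply Subtype.ext
      have h2 := minpoly.aeval K (x : L)
      rw [Polynomial.aeval_def, Polynomial.eval₂_eq_sum, Polynomial.sum] at h2
      have h3 (i : ℕ) : ((a i * x ^ i : w.valuationSubring) : L) =
          (algebraMap K L c)⁻¹ * (algebraMap K L (P.coeff i) * (x : L) ^ i) := by
        simp only [a, MulMemClass.coe_mul, SubmonoidClass.coe_pow, map_div₀]
        ring
      simp only [AddSubmonoidClass.coe_finsetSum, h3, ← Finset.mul_sum, P, h2, mul_zero,
        ZeroMemClass.coe_zero]
    simp only [Q, Polynomial.eval_finsetSum, Polynomial.eval_monomial]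
    simpa using congrArg (IsLocalRing.residue _) h1
  -- The coefficients of Q are residues of elements of K, so the q-power map permutes the finitely
  -- many roots of Q; two iterates of t coincide.
  have hfrob : Q.map (iterateFrobenius _ p f) = Q := by
    simp only [Q, Polynomial.map_sum, Polynomial.map_monomial]
    refine Finset.sum_congr rfl fun i _ ↦ ?_
    congr 1
    rw [iterateFrobenius_def, ← map_pow, residue_eq_iff]
    exact H.pow_q _ (hle i)
  have hstep (s) (hs : Q.eval s = 0) : Q.eval (s ^ p ^ f) = 0 := by
    have h1 := Polynomial.map_iterateFrobenius_expand p Q f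
    rw [Polynomial.map_expand, hfrob] at h1
    rw [← Polynomial.expand_eval, h1, Polynomial.eval_pow, hs, zero_pow (pow_ne_zero _ H.prime.ne_zero)]
  have hall (n : ℕ) : Q.eval (t ^ (p ^ f) ^ n) = 0 := by
    induction n with
    | zero => simpa using hroot
    | succ n ih => rw [pow_succ, pow_mul]; exact hstep _ ih
  have hfin : ¬ Function.Injective fun n : ℕ ↦ (⟨t ^ (p ^ f) ^ n, by
      rw [Multiset.mem_toFinset, Polynomial.mem_roots hQ]; exact hall n⟩ : Q.roots.toFinset) :=
    not_injective_infinite_finite _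
  obtain ⟨i, j, hij, hne⟩ := Function.not_injective_iff.1 hfin
  simp only [Subtype.mk.injEq] at hij
  wlog hlt : i < j generalizing i j
  · exact this j i hne.symm hij.symm (lt_of_le_of_ne (not_lt.1 hlt) hne.symm)
  refine ⟨j - i, Nat.sub_pos_of_lt hlt, ?_⟩
  have h1 : j = (j - i) + i := by omega
  rw [h1, pow_add, pow_mul, ← pow_mul p] at hij
  exact (iterateFrobenius_inj _ p (f * i) hij).symm

/-- Defectlessness: the wild inertia group is trivial if the ramification index is prime
to the residue characteristic. -/
theorem IsLocalBase.wildInertia_eq_bot [FiniteDimensional K L] {w : Valuation L Γ} {π : K}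
    {p f : ℕ} (H : IsLocalBase w π p f) (he : ¬ p ∣ ramificationIndex K w) :
    wildInertia K w = ⊥ := by
  rw [Subgroup.eq_bot_iff_forall]
  intro σ hσ
  set e := ramificationIndex K w
  have he0 : e ≠ 0 := fun h ↦ he (h ▸ dvd_zero p)
  obtain ⟨a, ha⟩ := exists_pow_prime_pow_eq_one H.prime H.val_p hσ
  -- The norm to the fixed field of σ, up to a power: p ^ a need only be a multiple of the order of
  -- σ.
  let N (x : L) : L := ∏ i ∈ Finset.range (p ^ a), (σ ^ i) x
  have hN (x : L) : σ (N x) = N x := by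
    have h1 (i : ℕ) : σ ((σ ^ i) x) = (σ ^ (i + 1)) x := by rw [pow_succ', AlgEquiv.mul_apply]
    by_cases hx : x = 0
    · simp [N, hx]
    simp only [N, map_prod, h1]
    have h2 := Finset.prod_range_succ' (fun i ↦ (σ ^ i) x) (p ^ a)
    rw [Finset.prod_range_succ, ha, pow_zero] at h2
    exact (mul_right_cancel₀ (by simpa using hx) h2).symm
  -- Bézout: w x ^ p ^ a is the value of the fixed element N x, w x ^ e is a value of K, and p ^ a
  -- is prime to e.
  have hval (x : L) (hx : x ≠ 0) : ∃ y : L, σ y = y ∧ w y = w x := by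
    obtain ⟨z, hz, hz'⟩ := exists_val_pow_ramificationIndex (K := K) w hx
    have hNx : w (N x) = w x ^ p ^ a := by
      simp only [N, map_prod, H.inv, Finset.prod_const, Finset.card_range]
    have hc : IsCoprime ((p ^ a : ℕ) : ℤ) (e : ℤ) := Nat.isCoprime_iff_coprime.2
      (((Nat.Prime.coprime_iff_not_dvd H.prime).2 he).pow_left a)
    obtain ⟨s, t, hst⟩ := hc
    refine ⟨N x ^ s * algebraMap K L z ^ t, by simp [hN, map_zpow₀], ?_⟩
    have hwx := (w.ne_zero_iff).2 hx
    rw [map_mul, map_zpow₀, map_zpow₀, hNx, hz', ← zpow_natCast, ← zpow_natCast, ← zpow_mul,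
      ← zpow_mul, ← zpow_add₀ hwx, mul_comm, mul_comm (e : ℤ), hst, zpow_one]
  -- Wild σ preserves residues, so N (x ^ p ^ r) has residue x ^ p ^ (r + a). The exponent r makes p
  -- ^ (r + a) a power of q ^ M, which fixes the residue of x.
  have hres (x : L) (hx : w x ≤ 1) : ∃ y : L, σ y = y ∧ w (x - y) < 1 := by
    have := H.charP_residueField
    have := Fact.mk H.prime
    let X : w.valuationSubring := ⟨x, hx⟩
    obtain ⟨M, hM, hMt⟩ := H.exists_pow_eq (IsLocalRing.residue _ X)
    have hmul (j : ℕ) : IsLocalRing.residue _ X ^ (p ^ f) ^ (M * j) = IsLocalRing.residue _ X := by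
      induction j with
      | zero => simp
      | succ j ih => rw [mul_add, pow_add, pow_mul, ih, mul_one, hMt]
    have hle : a ≤ f * (M * a) := by
      have : 1 ≤ f * M := Nat.mul_pos (Nat.pos_of_ne_zero H.f_ne) hM
      nlinarith
    set r := f * (M * a) - a with hr
    let Y : w.valuationSubring :=
      ∏ i ∈ Finset.range (p ^ a), integerMap w H.inv (σ ^ i) (X ^ p ^ r)
    refine ⟨N (x ^ p ^ r), hN _, ?_⟩
    have hY : (Y : L) = N (x ^ p ^ r) := by
      simp [Y, N, integerMap, X]
    rw [← hY]
    refine (residue_eq_iff X Y).1 ?_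
    have h1 (i : ℕ) : IsLocalRing.residue _ (integerMap w H.inv (σ ^ i) (X ^ p ^ r)) =
        IsLocalRing.residue _ (X ^ p ^ r) := by
      rw [residue_eq_iff]
      by_cases h0 : ((X ^ p ^ r : w.valuationSubring) : L) = 0
      · simp [integerMap, h0]
      · exact ((pow_mem hσ i).2 _ h0).trans_le (X ^ p ^ r).2
    simp only [Y, map_prod, h1, Finset.prod_const, Finset.card_range]
    rw [map_pow, ← pow_mul, ← pow_add, hr, Nat.sub_add_cancel hle, pow_mul, hmul]
  -- The fixed field of σ has all values and residues of L, so fixed approximations to a moved x can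
  -- always be improved. Values are measured by integers: e-th powers of values are powers of w π.
  by_contra hne
  obtain ⟨x, hx⟩ : ∃ x, σ x ≠ x := by
    by_contra! h
    exact hne (AlgEquiv.ext h)
  have hn (y : L) (hy : y ≠ 0) : ∃ n : ℤ, w y ^ e = w (algebraMap K L π) ^ n := by
    obtain ⟨z, hz, hz'⟩ := exists_val_pow_ramificationIndex (K := K) w hy
    rw [← hz']
    exact H.gen z hz
  have hπ0 : 0 < w (algebraMap K L π) := by simpa [zero_lt_iff] using H.pi_ne
  have hlt {y z : L} {m n : ℤ} (hyz : w y < w z) (hy : w y ^ e = w (algebraMap K L π) ^ m)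
      (hz : w z ^ e = w (algebraMap K L π) ^ n) : n < m := by
    have := pow_lt_pow_left₀ hyz zero_le he0
    rwa [hy, hz, zpow_lt_zpow_iff_right_of_lt_one₀ hπ0 H.pi_lt] at this
  have hsub {y : L} (hy : σ y = y) : x - y ≠ 0 := fun h ↦ hx (by rw [sub_eq_zero.1 h, hy])
  obtain ⟨d, hd⟩ := hn _ (sub_ne_zero.2 hx)
  -- Subtracting a fixed y leaves σ x - x unchanged, so wildness gives w (σ x - x) < w (x - y):
  -- approximation cannot go on forever.
  have hbound {y : L} (hy : σ y = y) {n : ℤ} (hn : w (x - y) ^ e = w (algebraMap K L π) ^ n) :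
      n < d := by
    refine hlt ?_ hd hn
    have := hσ.2 _ (hsub hy)
    rwa [map_sub σ, hy, sub_sub_sub_cancel_right] at this
  obtain ⟨n₀, hn₀⟩ := hn x (by simpa using hsub (map_zero σ))
  have happrox (j : ℕ) : ∃ y, σ y = y ∧ ∃ n : ℤ, w (x - y) ^ e = w (algebraMap K L π) ^ n ∧
      n₀ + j ≤ n := by
    induction j with
    | zero => exact ⟨0, map_zero σ, n₀, by simpa using hn₀, by simp⟩
    | succ j ih =>
      obtain ⟨y, hy, n, hyn, hjn⟩ := ih
      obtain ⟨b, hb, hwb⟩ := hval _ (hsub hy)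
      have hwb0 : w b ≠ 0 := by rw [hwb]; exact (w.ne_zero_iff).2 (hsub hy)
      have hb0 : b ≠ 0 := (w.ne_zero_iff).1 hwb0
      obtain ⟨c, hc, hwc⟩ := hres ((x - y) / b) (by rw [map_div₀, ← hwb, div_self hwb0])
      have hy' : σ (y + b * c) = y + b * c := by simp [hy, hb, hc]
      obtain ⟨n', hn'⟩ := hn _ (hsub hy')
      refine ⟨_, hy', n', hn', ?_⟩
      have : n < n' := by
        refine hlt ?_ hn' hyn
        have h1 : x - (y + b * c) = b * ((x - y) / b - c) := by field_simp; ring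
        rw [h1, map_mul, ← hwb]
        exact mul_lt_of_lt_one_right (zero_lt_iff.2 hwb0) hwc
      push_cast
      omega
  obtain ⟨y, hy, n, hyn, hjn⟩ := happrox (d - n₀).toNat
  have := hbound hy hyn
  omega

end Wild
-- Lifting residue automorphisms; Frobenius and tame characters
section Lift

variable {K L Γ : Type*} [Field K] [Field L] [Algebra K L] [LinearOrderedCommGroupWithZero Γ]

theorem isOpen_setOf_apply_eq [Algebra.IsAlgebraic K L] (x y : L) :
    IsOpen {σ : Gal(L/K) | σ x = y} := by
  rw [isOpen_iff_mem_nhds]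
  intro σ hσ
  have : FiniteDimensional K (IntermediateField.adjoin K {x}) :=
    IntermediateField.adjoin.finiteDimensional (Algebra.IsIntegral.isIntegral x)
  have h1 := ((IntermediateField.fixingSubgroup_isOpen (IntermediateField.adjoin K {x})).leftCoset
    σ).mem_nhds (x := σ) ⟨1, one_mem _, mul_one σ⟩
  refine Filter.mem_of_superset h1 ?_
  rintro _ ⟨τ, hτ, rfl⟩
  have : τ x = x := hτ ⟨x, IntermediateField.mem_adjoin_simple_self K x⟩
  simpa [this] using hσ

/-- The action of a group of Galois invariant automorphisms on the valuation ring. -/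
@[reducible]
def integerAction (w : Valuation L Γ) (hw : ∀ (σ : Gal(L/K)) (x : L), w (σ x) = w x)
    (N : Subgroup Gal(L/K)) : MulSemiringAction N w.valuationSubring where
  smul σ := integerMap w hw σ
  one_smul _ := rfl
  mul_smul _ _ _ := rfl
  smul_zero σ := map_zero (integerMap w hw σ)
  smul_add σ := map_add (integerMap w hw σ)
  smul_one σ := map_one (integerMap w hw σ)
  smul_mul σ := map_mul (integerMap w hw σ)

/-- Surjectivity of the decomposition group onto residue automorphisms, for the compact group N
acting continuously on the discrete valuation ring. The hypothesis on τ says that it is linear over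
the residues of the N-invariants. -/
theorem exists_lift_residueField [IsGalois K L] {w : Valuation L Γ}
    (hw : ∀ (σ : Gal(L/K)) (x : L), w (σ x) = w x) (N : Subgroup Gal(L/K))
    (hN : IsClosed (N : Set Gal(L/K)))
    (τ : IsLocalRing.ResidueField w.valuationSubring ≃+* IsLocalRing.ResidueField w.valuationSubring)
    (hτ : ∀ b : w.valuationSubring, (∀ σ ∈ N, σ (b : L) = b) →
      τ (IsLocalRing.residue _ b) = IsLocalRing.residue _ b) :
    ∃ σ ∈ N, ∀ b, IsLocalRing.residue _ (integerMap w hw σ b) = τ (IsLocalRing.residue _ b) := by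
  let := integerAction w hw N
  let : TopologicalSpace w.valuationSubring := ⊥
  have : DiscreteTopology w.valuationSubring := ⟨rfl⟩
  have : CompactSpace N := isCompact_iff_compactSpace.1 hN.isCompact
  have : ContinuousSMul N w.valuationSubring := by
    refine ⟨continuous_prod_of_discrete_right.2 fun b ↦ ?_⟩
    refine continuous_discrete_rng.2 fun c ↦ ?_
    convert (isOpen_setOf_apply_eq (K := K) (b : L) c).preimage
      (continuous_subtype_val (p := (· ∈ N))) using 1
    ext σ
    exact Subtype.ext_iff
  let A := FixedPoints.subalgebra ℤ w.valuationSubring N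
  have : Algebra.IsInvariant A w.valuationSubring N := ⟨fun b hb ↦ ⟨⟨b, hb⟩, rfl⟩⟩
  have : SMulCommClass N A w.valuationSubring := ⟨fun g a b ↦ by
    rw [Algebra.smul_def, smul_mul', Algebra.smul_def]
    congr 1
    exact a.2 g⟩
  let Q := IsLocalRing.maximalIdeal w.valuationSubring
  let P := Q.under A
  let τ' : (w.valuationSubring ⧸ Q) ≃ₐ[A ⧸ P] (w.valuationSubring ⧸ Q) :=
    AlgEquiv.ofRingEquiv (f := τ) (by
      refine Quotient.ind fun a ↦ ?_
      exact hτ a.1 fun σ hσ ↦ congrArg Subtype.val (a.2 ⟨σ, hσ⟩))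
  obtain ⟨σ, hσ⟩ := Ideal.Quotient.stabilizerHom_surjective_of_profinite (G := N) P Q τ'
  refine ⟨σ.1, σ.1.2, fun b ↦ ?_⟩
  exact DFunLike.congr_fun hσ (Ideal.Quotient.mk Q b)

/-- The q-power map is onto because each residue t satisfies t ^ q ^ M = t, and it fixes the
residues of K, so it lifts. -/
theorem IsLocalBase.exists_frobenius [IsGalois K L] {w : Valuation L Γ} {π : K} {p f : ℕ}
    (H : IsLocalBase w π p f) :
    ∃ σ : Gal(L/K), ∀ x : L, w x ≤ 1 → w (σ x - x ^ p ^ f) < 1 := by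
  have := H.charP_residueField
  have := Fact.mk H.prime
  have hsurj : Function.Surjective
      (iterateFrobenius (IsLocalRing.ResidueField w.valuationSubring) p f) := by
    intro t
    obtain ⟨M, hM, h⟩ := H.exists_pow_eq t
    refine ⟨t ^ (p ^ f) ^ (M - 1), ?_⟩
    rw [iterateFrobenius_def, ← pow_mul, ← pow_succ, Nat.sub_add_cancel hM, h]
  have hbij : Function.Bijective
      (iterateFrobenius (IsLocalRing.ResidueField w.valuationSubring) p f) :=
    ⟨iterateFrobenius_inj _ p f, hsurj⟩
  obtain ⟨σ, -, hσ⟩ := exists_lift_residueField H.inv ⊤ isClosed_univ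
    (RingEquiv.ofBijective (iterateFrobenius _ p f) hbij) (by
      rintro ⟨b, hb'⟩ hb
      obtain ⟨a, ha⟩ := (InfiniteGalois.mem_range_algebraMap_iff_fixed b).2 fun σ ↦ hb σ trivial
      change b ∈ w.valuationSubring.toSubring at hb'
      change IsLocalRing.residue _ _ ^ p ^ f = _
      rw [← map_pow, residue_eq_iff]
      subst ha
      exact H.pow_q a hb')
  refine ⟨σ, fun x hx ↦ ?_⟩
  have : _ = IsLocalRing.residue _ _ ^ p ^ f := hσ ⟨x, hx⟩
  rw [← map_pow, residue_eq_iff] at this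
  exact this

/-- On the inertia group, the tame character of `x` is multiplicative. -/
theorem val_pow_div_sub_lt {w : Valuation L Γ} {σ : Gal(L/K)} (hσ : σ ∈ inertia K w) {x : L}
    (hx : x ≠ 0) (n : ℕ) : w ((σ ^ n) x / x - (σ x / x) ^ n) < 1 := by
  have hwx : w x ≠ 0 := (w.ne_zero_iff).2 hx
  have hu : w (σ x / x) = 1 := by rw [map_div₀, hσ.1, div_self hwx]
  induction n with
  | zero => simp [hx]
  | succ n ih =>
    have hy : w ((σ ^ n) x / x) = 1 := by
      rw [map_div₀, (pow_mem hσ n).1, div_self hwx]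
    have h1 := hσ.2 _ hy.le
    have hσx : σ x ≠ 0 := by simpa using hx
    have h2 : (σ ^ (n + 1)) x / x - (σ x / x) ^ (n + 1) = (σ x / x) *
        ((σ ((σ ^ n) x / x) - (σ ^ n) x / x) + ((σ ^ n) x / x - (σ x / x) ^ n)) := by
      have h3 : (σ x / x) * (σ ((σ ^ n) x) / σ x) = σ ((σ ^ n) x) / x := by field_simp
      rw [pow_succ' σ, AlgEquiv.mul_apply, map_div₀]
      linear_combination -h3
    rw [h2, map_mul, hu, one_mul]
    exact w.map_add_lt h1 ih

/-- In an abelian extension whose ramification index is prime to the residue characteristic,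
the inertia group is killed by the number of units of the residue field. -/
theorem IsLocalBase.pow_eq_one_of_mem_inertia [FiniteDimensional K L] [IsAbelianGalois K L]
    {w : Valuation L Γ} {π : K} {p f : ℕ} (H : IsLocalBase w π p f)
    (he : ¬ p ∣ ramificationIndex K w) {σ : Gal(L/K)} (hσ : σ ∈ inertia K w) :
    σ ^ (p ^ f - 1) = 1 := by
  have hq : 0 < p ^ f := pow_pos H.prime.pos f
  obtain ⟨φ, hφ⟩ := H.exists_frobenius
  rw [← Subgroup.mem_bot, ← H.wildInertia_eq_bot he]
  refine ⟨H.inv _, fun x hx ↦ ?_⟩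
  have hwx : w x ≠ 0 := (w.ne_zero_iff).2 hx
  have hu' : w (σ x / x) = 1 := by rw [map_div₀, H.inv, div_self hwx]
  let U : w.valuationSubring := ⟨σ x / x, hu'.le⟩
  have hunit {y : L} (hy0 : y ≠ 0) (hy1 : w y = 1) : w (σ y / y - 1) < 1 := by
    rw [div_sub_one hy0, map_div₀, hy1, div_one]
    exact hσ.2 y hy1.le
  -- the residue of `σ x / x` is fixed by Frobenius
  have h1 : w (φ (σ x / x) - σ x / x) < 1 := by
    have hφx : w (φ x / x) = 1 := by rw [map_div₀, H.inv, div_self hwx]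
    have hx' : φ x ≠ 0 := by simpa using hx
    have h2 := hunit (div_ne_zero hx' hx) hφx
    -- Commutativity enters here: φ changes σ x / x only by the factor σ u / u for the unit u = φ x
    -- / x, and inertia makes this factor congruent to 1.
    have hcomm : φ (σ x) = σ (φ x) := by
      rw [← AlgEquiv.mul_apply, ← AlgEquiv.mul_apply, IsMulCommutative.is_comm.comm φ σ]
    have hσx : σ x ≠ 0 := by simpa using hx
    have h3 : φ (σ x / x) - σ x / x = σ x / x * (σ (φ x / x) / (φ x / x) - 1) := by
      rw [map_div₀, map_div₀, hcomm]
      field_simp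
    rw [h3, map_mul, hu', one_mul]
    exact h2
  have hU : IsLocalRing.residue _ U ^ (p ^ f - 1) = 1 := by
    have h2 : IsLocalRing.residue _ U ≠ 0 := by
      rw [Ne, residue_eq_zero_iff]
      exact hu'.not_lt
    refine mul_right_cancel₀ h2 ?_
    rw [← pow_succ, Nat.sub_add_cancel hq, one_mul, ← map_pow, residue_eq_iff]
    have := w.map_sub_lt h1 (hφ _ hu'.le)
    rwa [sub_sub_sub_cancel_left] at this
  have h2 := val_pow_div_sub_lt hσ hx (p ^ f - 1)
  rw [← map_pow, ← map_one (IsLocalRing.residue w.valuationSubring), residue_eq_iff] at hU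
  have h3 := w.map_add_lt h2 hU
  have h4 : (σ ^ (p ^ f - 1)) x - x = x * ((σ ^ (p ^ f - 1)) x / x - (σ x / x) ^ (p ^ f - 1) +
      (((U ^ (p ^ f - 1) : w.valuationSubring) : L) - (1 : w.valuationSubring))) := by
    simp only [U, SubmonoidClass.coe_pow, OneMemClass.coe_one]
    field_simp
    ring
  rw [h4, map_mul]
  exact mul_lt_of_lt_one_right (zero_lt_iff.2 hwx) h3

theorem IsLocalBase.not_dvd_pow_sub_one {w : Valuation L Γ} {π : K} {p f : ℕ}
    (H : IsLocalBase w π p f) {n : ℕ} (hn : n ≠ 0) : ¬ p ∣ p ^ n - 1 := by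
  intro h
  have h2 := (Nat.dvd_sub_iff_right (Nat.one_le_pow _ _ H.prime.pos) (dvd_pow_self p hn)).1 h
  exact H.prime.one_lt.ne' (Nat.dvd_one.1 h2)

/-- If the inertia group is killed by the number of units of the residue field, then so is the
quotient of the value groups. -/
theorem IsLocalBase.exists_val_eq_pow [FiniteDimensional K L] [IsGalois K L]
    {w : Valuation L Γ} {π : K} {p f : ℕ} (H : IsLocalBase w π p f)
    (hI : ∀ σ ∈ inertia K w, σ ^ (p ^ f - 1) = 1) {x : L} (hx : x ≠ 0) :
    ∃ z : K, w (algebraMap K L z) = w x ^ (p ^ f - 1) := by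
  have hwx : w x ≠ 0 := (w.ne_zero_iff).2 hx
  -- By Cauchy, otherwise inertia has an element of order p, which would divide q - 1.
  have hcard : ¬ p ∣ Nat.card (inertia K w) := by
    intro h
    have := Fact.mk H.prime
    obtain ⟨σ, hσ⟩ := exists_prime_orderOf_dvd_card' p h
    have h1 : σ ^ (p ^ f - 1) = 1 := Subtype.ext (hI σ σ.2)
    rw [← orderOf_dvd_iff_pow_eq_one, hσ] at h1
    exact H.not_dvd_pow_sub_one H.f_ne h1
  rw [← map_pow]
  -- The tame characters of x ^ (q - 1) are those of x raised to the power q - 1, hence trivial.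
  refine exists_val_eq H.inv (val_natCast_eq_one H.prime H.val_p hcard) (pow_ne_zero _ hx)
    fun σ hσ ↦ ?_
  have h1 := val_pow_div_sub_lt hσ hx (p ^ f - 1)
  rw [hI σ hσ, AlgEquiv.one_apply, div_self hx] at h1
  have h2 : σ (x ^ (p ^ f - 1)) - x ^ (p ^ f - 1) =
      - (x ^ (p ^ f - 1) * (1 - (σ x / x) ^ (p ^ f - 1))) := by
    rw [map_pow, div_pow]
    field_simp
    ring
  rw [h2, Valuation.map_neg, map_mul]
  exact mul_lt_of_lt_one_right (zero_lt_iff.2 ((w.ne_zero_iff).2 (pow_ne_zero _ hx))) h1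

end Lift
-- Consequences of the Henselian property
section Henselian

variable {K : Type u} [Field K] {Γ₀ : Type v} [LinearOrderedCommGroupWithZero Γ₀]
  {v : Valuation K Γ₀}

theorem hasExtension_valuation_valuationSubring {L : Type*} [Field L] [Algebra K L] {Γ : Type*}
    [LinearOrderedCommGroupWithZero Γ] (w : Valuation L Γ) [v.HasExtension w] :
    v.HasExtension w.valuationSubring.valuation :=
  ⟨(Valuation.HasExtension.val_isEquiv_comap (vR := v) (vA := w)).trans
    (w.isEquiv_valuation_valuationSubring.comap _)⟩

/-- `IsHenselian` compares only valuations with values in the universe of K; passing to the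
canonical valuation of the valuation ring removes this restriction. -/
theorem IsHenselian.isEquiv (hv : IsHenselian v) {L : Type u} [Field L] [Algebra K L]
    [Algebra.IsAlgebraic K L] {Γ Γ' : Type*} [LinearOrderedCommGroupWithZero Γ]
    [LinearOrderedCommGroupWithZero Γ'] (w : Valuation L Γ) (w' : Valuation L Γ')
    [v.HasExtension w] [v.HasExtension w'] : w.IsEquiv w' :=
  w.isEquiv_valuation_valuationSubring.trans (((hv L).2 _ _ _ _
    (hasExtension_valuation_valuationSubring w) (hasExtension_valuation_valuationSubring w')).trans
    w'.isEquiv_valuation_valuationSubring.symm)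

/-- Uniqueness gives only that w ∘ σ and w are equivalent. Equality holds because x has a finite
orbit: a strict inequality between w x and w (σ x) would propagate around it. -/
theorem IsHenselian.val_map (hv : IsHenselian v) {L : Type u} [Field L] [Algebra K L]
    [Algebra.IsAlgebraic K L] {Γ : Type*} [LinearOrderedCommGroupWithZero Γ]
    (w : Valuation L Γ) [v.HasExtension w] (σ : Gal(L/K)) (x : L) : w (σ x) = w x := by
  have hext : v.HasExtension (w.comap (σ : L →+* L)) := ⟨by
    have h := Valuation.HasExtension.val_isEquiv_comap (vR := v) (vA := w)
    convert h using 1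
    ext y
    simp⟩
  have heq := hv.isEquiv (w.comap (σ : L →+* L)) w
  have hlt (a b : L) : w (σ a) < w (σ b) ↔ w a < w b := heq.lt_iff_lt
  have hmaps : Set.MapsTo σ ((minpoly K x).rootSet L) ((minpoly K x).rootSet L) := fun y hy ↦ by
    rw [Polynomial.mem_rootSet] at hy ⊢
    exact ⟨hy.1, by rw [Polynomial.aeval_algHom_apply, hy.2, map_zero]⟩
  have hx : x ∈ (minpoly K x).rootSet L := by
    rw [Polynomial.mem_rootSet]
    exact ⟨minpoly.ne_zero (Algebra.IsIntegral.isIntegral x), minpoly.aeval K x⟩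
  obtain ⟨n, hn, h⟩ : ∃ n > 0, (σ ^ n) x = x := by
    obtain ⟨n, hn, h⟩ := Function.Injective.mem_periodicPts (f := hmaps.restrict) (by
      intro a b hab
      exact Subtype.ext (σ.injective (congrArg Subtype.val hab))) ⟨x, hx⟩
    refine ⟨n, hn, ?_⟩
    have h1 := congrArg Subtype.val h
    rw [Set.MapsTo.iterate_restrict] at h1
    simpa [AlgEquiv.coe_pow] using h1
  have hiter (i : ℕ) (a b : L) : w ((σ ^ i) a) < w ((σ ^ i) b) ↔ w a < w b := by
    induction i with
    | zero => rfl
    | succ i ih => rw [pow_succ', AlgEquiv.mul_apply, AlgEquiv.mul_apply, hlt, ih]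
  refine le_antisymm (not_lt.1 fun hgt ↦ ?_) (not_lt.1 fun hgt ↦ ?_)
  · have hmono : StrictMono fun i : ℕ ↦ w ((σ ^ i) x) := strictMono_nat_of_lt_succ fun i ↦ by
      rw [pow_succ, AlgEquiv.mul_apply]
      exact (hiter i _ _).2 hgt
    have := hmono hn
    simp [h] at this
  · have hmono : StrictAnti fun i : ℕ ↦ w ((σ ^ i) x) := strictAnti_nat_of_succ_lt fun i ↦ by
      rw [pow_succ, AlgEquiv.mul_apply]
      exact (hiter i _ _).2 hgt
    have := hmono hn
    simp [h] at this

theorem exists_isLocalBase (hd : IsDiscrete v) (hk : Finite (Residue v)) :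
    ∃ (π : K) (f : ℕ), Nat.card (Residue v) = ringChar (Residue v) ^ f ∧
      IsLocalBase v π (ringChar (Residue v)) f := by
  obtain ⟨⟨g, hg⟩, hinf⟩ := hd
  have hg1 : g ≠ 1 := by
    rintro rfl
    have : Subsingleton (valueGroup v) := ⟨fun a b ↦ by
      obtain ⟨i, rfl⟩ := hg a
      obtain ⟨j, rfl⟩ := hg b
      simp⟩
    exact not_finite (valueGroup v)
  obtain ⟨g, hg, hg1⟩ : ∃ g : valueGroup v, (∀ x, x ∈ Subgroup.zpowers g) ∧ g < 1 := by
    rcases lt_or_gt_of_ne hg1 with h | h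
    · exact ⟨g, hg, h⟩
    · exact ⟨g⁻¹, fun x ↦ by rw [Subgroup.zpowers_inv]; exact hg x, inv_lt_one'.2 h⟩
  obtain ⟨π, hπ, hπg⟩ := mem_valueGroup_iff.1 g.2
  have : Fintype (Residue v) := Fintype.ofFinite _
  obtain ⟨n, hp, hn⟩ := FiniteField.card (Residue v) (ringChar (Residue v))
  refine ⟨π, n, by rw [Nat.card_eq_fintype_card, hn], hp, n.ne_zero, ?_, ?_, hπ, ?_, ?_, ?_⟩
  · have h := CharP.cast_eq_zero (Residue v) (ringChar (Residue v))
    rw [← map_natCast (IsLocalRing.residue _), residue_eq_zero_iff] at h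
    exact_mod_cast h
  · intro x hx
    have h := FiniteField.pow_card (IsLocalRing.residue v.valuationSubring ⟨x, hx⟩)
    rw [← hn, ← map_pow, residue_eq_iff] at *
    exact h
  · rw [Algebra.algebraMap_self_apply, hπg]
    exact_mod_cast hg1
  · intro x hx
    obtain ⟨j, hj⟩ := hg ⟨Units.mk0 (v x) ((v.ne_zero_iff).2 hx), mem_valueGroup_iff.2 ⟨x, hx, rfl⟩⟩
    refine ⟨j, ?_⟩
    have := congrArg (fun g : valueGroup v ↦ ((g : Γ₀ˣ) : Γ₀)) hj
    simpa [hπg] using this.symm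
  · intro σ x
    exact congrArg v (σ.commutes x)

theorem IsHenselian.isLocalBase (hv : IsHenselian v) {π : K} {p f : ℕ} (H : IsLocalBase v π p f)
    {L : Type u} [Field L] [Algebra K L]
    [Algebra.IsAlgebraic K L] {Γ : Type*} [LinearOrderedCommGroupWithZero Γ]
    (w : Valuation L Γ) [v.HasExtension w] : IsLocalBase w π p f where
  prime := H.prime
  f_ne := H.f_ne
  val_p := by
    rw [← map_natCast (algebraMap K L), Valuation.HasExtension.val_map_lt_one_iff v]
    exact H.val_p
  pow_q x hx := by
    rw [← map_pow, ← map_sub, Valuation.HasExtension.val_map_lt_one_iff v]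
    exact H.pow_q x ((Valuation.HasExtension.val_map_le_one_iff v w x).1 hx)
  pi_ne := H.pi_ne
  pi_lt := (Valuation.HasExtension.val_map_lt_one_iff v w _).2 H.pi_lt
  gen x hx := by
    obtain ⟨j, hj⟩ := H.gen x hx
    refine ⟨j, ?_⟩
    rw [← map_zpow₀, ← map_zpow₀, Valuation.HasExtension.val_map_eq_iff v, map_zpow₀]
    exact hj
  inv := hv.val_map w

end Henselian

/-! ### Composita of abelian extensions -/

section Abelian

variable {K Ω : Type*} [Field K] [Field Ω] [Algebra K Ω]

theorem isAbelianGalois_sSup [IsGalois K Ω] (S : Set (IntermediateField K Ω))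
    (hS : ∀ L ∈ S, IsAbelianGalois K L) :
    IsAbelianGalois K (sSup S : IntermediateField K Ω) := by
  have hn : Normal K (sSup S : IntermediateField K Ω) := by
    rw [sSup_eq_iSup']
    have (i : S) : Normal K i.1 := (hS i.1 i.2).to_normal
    exact IntermediateField.normal_iSup K Ω _
  have : IsGalois K (sSup S : IntermediateField K Ω) := { }
  refine { is_comm := ⟨fun σ τ ↦ ?_⟩ }
  obtain ⟨σ, rfl⟩ := AlgEquiv.restrictNormalHom_surjective Ω σ
  obtain ⟨τ, rfl⟩ := AlgEquiv.restrictNormalHom_surjective Ω τ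
  -- The commutator of two lifts fixes every member of S, hence the compositum.
  have hle : sSup S ≤ IntermediateField.fixedField (Subgroup.zpowers ((σ * τ)⁻¹ * (τ * σ))) := by
    refine sSup_le fun L hL x hx ↦ ?_
    have := hS L hL
    rw [IntermediateField.mem_fixedField_iff]
    intro ρ hρ
    have hfix : ((σ * τ)⁻¹ * (τ * σ)) • x = x := by
      have h1 : AlgEquiv.restrictNormalHom L (σ * τ) = AlgEquiv.restrictNormalHom L (τ * σ) := by
        rw [map_mul, map_mul, IsMulCommutative.is_comm.comm]
      have h2 := congrArg (fun g : Gal(L/K) ↦ ((g ⟨x, hx⟩ : L) : Ω)) h1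
      simp only [AlgEquiv.restrictNormalHom_apply] at h2
      rw [mul_smul, inv_smul_eq_iff]
      exact h2.symm
    exact (Subgroup.zpowers_le.2 (MulAction.mem_stabilizer_iff.2 hfix)) hρ
  ext x
  have h := (IntermediateField.mem_fixedField_iff _ _).1 (hle x.2) _ (Subgroup.mem_zpowers _)
  rw [← map_mul, ← map_mul, AlgEquiv.restrictNormalHom_apply, AlgEquiv.restrictNormalHom_apply]
  rw [← AlgEquiv.smul_def, mul_smul, inv_smul_eq_iff] at h
  exact h.symm

end Abelian
-- Cyclotomic extensions and roots of a uniformizer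
section Tame

variable {K L Γ : Type*} [Field K] [Field L] [Algebra K L] [LinearOrderedCommGroupWithZero Γ]

theorem ramificationIndex_eq_one {w : Valuation L Γ}
    (h : ∀ x : L, x ≠ 0 → ∃ z : K, w (algebraMap K L z) = w x) : ramificationIndex K w = 1 := by
  rw [ramificationIndex, Subgroup.relIndex_eq_one]
  intro g hg
  obtain ⟨x, hx, hxg⟩ := mem_valueGroup_iff.1 hg
  obtain ⟨z, hz⟩ := h x hx
  refine mem_valueGroup_iff.2 ⟨z, ?_, hz.trans hxg⟩
  rintro rfl
  rw [map_zero, map_zero, eq_comm, map_eq_zero] at hz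
  exact hx hz

/-- The inertia group fixes the roots of unity of order prime to the residue characteristic. -/
theorem apply_eq_of_pow_eq_one {w : Valuation L Γ} {m : ℕ} (hm : w (m : L) = 1) (hm0 : m ≠ 0)
    {x y : L} (hx : x ^ m = 1) (hy : y ^ m = 1) (hxy : w (y - x) < 1) : y = x := by
  have hx0 : x ≠ 0 := by rintro rfl; simp [hm0] at hx
  have hwx : w x = 1 := by
    have := congrArg w hx
    rw [map_pow, map_one] at this
    exact (pow_eq_one_iff_of_nonneg zero_le hm0).1 this
  have h := eq_zero_of_one_add_pow_eq_one hm (t := (y - x) / x)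
    (by rwa [map_div₀, hwx, div_one])
    (by rw [one_add_div hx0, add_sub_cancel, div_pow, hx, hy, div_one])
  rw [div_eq_zero_iff, or_iff_left hx0, sub_eq_zero] at h
  exact h

theorem IsLocalBase.val_card_units {w : Valuation L Γ} {π : K} {p f : ℕ} (H : IsLocalBase w π p f)
    {n : ℕ} (hn : n ≠ 0) : w ((p ^ n - 1 : ℕ) : L) = 1 :=
  val_natCast_eq_one H.prime H.val_p (H.not_dvd_pow_sub_one hn)

theorem IsLocalBase.card_units_ne {w : Valuation L Γ} {π : K} {p f : ℕ} (H : IsLocalBase w π p f)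
    {n : ℕ} (hn : n ≠ 0) : p ^ n - 1 ≠ 0 :=
  Nat.sub_ne_zero_of_lt (Nat.one_lt_pow hn H.prime.one_lt)

/-- Cyclotomic extensions of order prime to the residue characteristic are unramified. -/
theorem IsLocalBase.ramificationIndex_eq_one_of_cyclotomic [FiniteDimensional K L] [IsGalois K L]
    {w : Valuation L Γ} {π : K} {p f : ℕ} (H : IsLocalBase w π p f) {n : ℕ} (hn : n ≠ 0)
    {ζ : L} (hζ : ζ ^ (p ^ n - 1) = 1) (htop : IntermediateField.adjoin K {ζ} = ⊤) :
    ramificationIndex K w = 1 := by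
  -- Roots of unity of order prime to p are determined by their residues, so inertia fixes the
  -- generator ζ.
  have hI : inertia K w = ⊥ := by
    rw [Subgroup.eq_bot_iff_forall]
    intro σ hσ
    have h0 : p ^ n - 1 ≠ 0 := H.card_units_ne hn
    have hwζ : w ζ = 1 := by
      have := congrArg w hζ
      rw [map_pow, map_one] at this
      exact (pow_eq_one_iff_of_nonneg zero_le h0).1 this
    have h1 : σ ζ = ζ := apply_eq_of_pow_eq_one (H.val_card_units hn) h0 hζ
      (by rw [← map_pow, hζ, map_one]) (hσ.2 ζ hwζ.le)
    have h2 : (⊤ : IntermediateField K L) ≤ IntermediateField.fixedField (Subgroup.zpowers σ) := by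
      rw [← htop, IntermediateField.adjoin_simple_le_iff, IntermediateField.mem_fixedField_iff]
      intro τ hτ
      exact (Subgroup.zpowers_le.2 (MulAction.mem_stabilizer_iff.2 (show σ • ζ = ζ from h1))) hτ
    ext x
    exact (IntermediateField.mem_fixedField_iff _ _).1 (h2 (IntermediateField.mem_top (x := x))) σ
      (Subgroup.mem_zpowers σ)
  refine ramificationIndex_eq_one fun x hx ↦ ?_
  refine exists_val_eq H.inv (by simp [hI]) hx fun σ hσ ↦ ?_
  rw [hI, Subgroup.mem_bot] at hσ
  simpa [hσ, zero_lt_iff] using hx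

/-- Additively, l has value 1/m of that of π, while the values of K are the integral multiples of
the value of π. -/
theorem IsLocalBase.dvd_of_val_pow_eq {w : Valuation L Γ} {π : K} {p f : ℕ}
    (H : IsLocalBase w π p f) {m : ℕ} {l : L} (hl : l ^ m = algebraMap K L π) {d : ℕ} {z : K}
    (hd : w l ^ d = w (algebraMap K L z)) : m ∣ d := by
  have hπ0 : 0 < w (algebraMap K L π) := by simpa [zero_lt_iff] using H.pi_ne
  have hl0 : w l ≠ 0 := by
    intro h
    rw [← hl, map_pow, h] at hπ0
    have hlt := H.pi_lt
    rw [← hl, map_pow, h] at hlt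
    rcases eq_or_ne m 0 with rfl | hm
    · simp at hlt
    · simp [hm] at hπ0
  have hz : z ≠ 0 := by
    rintro rfl
    rw [map_zero, map_zero] at hd
    exact pow_ne_zero d hl0 hd
  obtain ⟨j, hj⟩ := H.gen z hz
  have h1 : w (algebraMap K L π) ^ (d : ℤ) = w (algebraMap K L π) ^ (j * m : ℤ) := by
    rw [zpow_mul, ← hj, ← hd, ← hl, map_pow, zpow_natCast, zpow_natCast, ← pow_mul, ← pow_mul,
      mul_comm]
  have h2 := zpow_right_injective₀ hπ0 H.pi_lt.ne h1
  exact Int.natCast_dvd_natCast.1 ⟨j, by rw [h2, mul_comm]⟩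

section Radical

variable {w : Valuation L Γ} {π : K} {p f : ℕ} {l : L}

/-- The norm of l has value w l ^ [L : K], so m divides [L : K], the degree of the minimal
polynomial of l. That polynomial divides X ^ m - π, so the two agree. -/
theorem IsLocalBase.irreducible [FiniteDimensional K L] [IsGalois K L] (H : IsLocalBase w π p f)
    {m : ℕ} (hm : m ≠ 0) (hl : l ^ m = algebraMap K L π) (htop : IntermediateField.adjoin K {l} = ⊤) :
    Irreducible (Polynomial.X ^ m - Polynomial.C π) := by
  have hint : IsIntegral K l := Algebra.IsIntegral.isIntegral l
  have hdvd : m ∣ Module.finrank K L := by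
    refine H.dvd_of_val_pow_eq hl (z := Algebra.norm K l) ?_
    rw [Algebra.norm_eq_prod_automorphisms, map_prod]
    simp [H.inv, IsGalois.card_aut_eq_finrank, ← Nat.card_eq_fintype_card]
  have hle : m ≤ (minpoly K l).natDegree := by
    rw [← IntermediateField.adjoin.finrank hint, htop, IntermediateField.finrank_top']
    exact Nat.le_of_dvd Module.finrank_pos hdvd
  have hmonic := Polynomial.monic_X_pow_sub_C π hm
  have hd : minpoly K l ∣ Polynomial.X ^ m - Polynomial.C π := minpoly.dvd _ _ (by simp [hl])
  rw [Polynomial.eq_of_monic_of_dvd_of_natDegree_le (minpoly.monic hint) hmonic hd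
    (by rwa [Polynomial.natDegree_X_pow_sub_C])]
  exact minpoly.irreducible hint

/-- The extension generated by a root of order `p ^ f - 1` of a uniformizer is totally ramified. -/
theorem IsLocalBase.inertia_eq_top [FiniteDimensional K L] [IsGalois K L] (H : IsLocalBase w π p f)
    (hl : l ^ (p ^ f - 1) = algebraMap K L π) (htop : IntermediateField.adjoin K {l} = ⊤)
    (hcard : Nat.card Gal(L/K) = p ^ f - 1) : inertia K w = ⊤ := by
  have hw := H.val_card_units H.f_ne
  have hl0 : l ≠ 0 := by
    rintro rfl
    rw [zero_pow (H.card_units_ne H.f_ne)] at hl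
    exact H.pi_ne ((map_eq_zero _).1 hl.symm)
  set d := Nat.card (inertia K w) with hd_def
  have hdm : d ∣ p ^ f - 1 := hcard ▸ Subgroup.card_subgroup_dvd_card _
  have hwd : w (d : L) = 1 := by
    obtain ⟨c, hc⟩ := hdm
    refine le_antisymm (val_natCast_le_one w d) (not_lt.1 fun h ↦ ?_)
    rw [hc, Nat.cast_mul, map_mul] at hw
    exact (mul_lt_one_of_lt_of_le h (val_natCast_le_one w c)).ne hw
  -- For d the order of inertia, l ^ d has trivial tame characters, so its value comes from K; this
  -- forces q - 1 to divide d.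
  obtain ⟨z, hz⟩ := exists_val_eq H.inv (hd_def ▸ hwd) (pow_ne_zero d hl0) fun σ hσ ↦ by
    have h1 := val_pow_div_sub_lt hσ hl0 d
    have h3 : σ ^ d = 1 := by
      exact congrArg Subtype.val (pow_card_eq_one' (x := (⟨σ, hσ⟩ : inertia K w)))
    rw [h3, AlgEquiv.one_apply, div_self hl0] at h1
    have h2 : σ (l ^ d) - l ^ d = - (l ^ d * (1 - (σ l / l) ^ d)) := by
      rw [map_pow, div_pow]
      field_simp
      ring
    rw [h2, Valuation.map_neg, map_mul]
    exact mul_lt_of_lt_one_right (zero_lt_iff.2 ((w.ne_zero_iff).2 (pow_ne_zero _ hl0))) h1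
  rw [map_pow] at hz
  have h1 := H.dvd_of_val_pow_eq hl hz.symm
  exact Subgroup.eq_top_of_card_eq _ ((Nat.dvd_antisymm hdm h1).trans hcard.symm)

/-- Averaging over the Galois group: x minus its average is, up to sign, the average of the
differences σ x - x, all small when everything is inertia. -/
theorem exists_val_sub_lt_one [FiniteDimensional K L] [IsGalois K L]
    (hw : w (Nat.card Gal(L/K) : L) = 1) (hI : inertia K w = ⊤) {x : L} (hx : w x ≤ 1) :
    ∃ z : K, w (x - algebraMap K L z) < 1 := by
  refine ⟨(Nat.card Gal(L/K) : K)⁻¹ * Algebra.trace K L x, ?_⟩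
  have h0 : (Nat.card Gal(L/K) : L) ≠ 0 := by
    intro h
    rw [h, map_zero] at hw
    exact zero_ne_one hw
  have h1 : x - algebraMap K L ((Nat.card Gal(L/K) : K)⁻¹ * Algebra.trace K L x) =
      - ((Nat.card Gal(L/K) : L)⁻¹ * ∑ σ : Gal(L/K), (σ x - x)) := by
    rw [map_mul, trace_eq_sum_automorphisms, Finset.sum_sub_distrib, Finset.sum_const,
      Finset.card_univ, nsmul_eq_mul, ← Nat.card_eq_fintype_card, map_inv₀, map_natCast]
    field_simp
    ring
  rw [h1, Valuation.map_neg, map_mul, map_inv₀, hw, inv_one, one_mul]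
  refine w.map_sum_lt one_ne_zero fun σ _ ↦ ?_
  exact (hI ▸ Subgroup.mem_top σ : σ ∈ inertia K w).2 x hx

/-- The values of the extension are powers of the value of a root `l` of a uniformizer. -/
theorem IsLocalBase.exists_val_eq_zpow (H : IsLocalBase w π p f)
    {m : ℕ} (hm : m ≠ 0) (hl : l ^ m = algebraMap K L π) {x : L} (hx : x ≠ 0) {z : K}
    (h : w (algebraMap K L z) = w x ^ m) : ∃ j : ℤ, w x = w l ^ j := by
  have hz : z ≠ 0 := by
    rintro rfl
    rw [map_zero, map_zero, eq_comm, pow_eq_zero_iff hm, map_eq_zero] at h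
    exact hx h
  obtain ⟨j, hj⟩ := H.gen z hz
  refine ⟨j, (pow_left_inj₀ zero_le zero_le hm).1 ?_⟩
  rw [← h, hj, ← hl, map_pow, ← zpow_natCast, ← zpow_natCast, ← zpow_mul, ← zpow_mul, mul_comm]

theorem mem_zpowers_of_val_eq_zpow (hl : l ≠ 0)
    (h : ∀ x : L, x ≠ 0 → ∃ j : ℤ, w x = w l ^ j) (g : valueGroup w) :
    g ∈ Subgroup.zpowers (⟨Units.mk0 (w l) ((w.ne_zero_iff).2 hl),
      mem_valueGroup_iff.2 ⟨l, hl, rfl⟩⟩ : valueGroup w) := by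
  obtain ⟨x, hx, hxg⟩ := mem_valueGroup_iff.1 g.2
  obtain ⟨j, hj⟩ := h x hx
  refine ⟨j, Subtype.ext (Units.ext ?_)⟩
  rw [← hxg, hj]
  simp

theorem isDiscrete_of_val_eq_zpow (hl : l ≠ 0) (hlt : w l < 1)
    (h : ∀ x : L, x ≠ 0 → ∃ j : ℤ, w x = w l ^ j) : IsDiscrete w := by
  refine ⟨⟨_, mem_zpowers_of_val_eq_zpow hl h⟩, ?_⟩
  have hwl : 0 < w l := by simpa [zero_lt_iff] using hl
  refine Infinite.of_injective (fun j : ℤ ↦ (⟨Units.mk0 (w l) ((w.ne_zero_iff).2 hl),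
      mem_valueGroup_iff.2 ⟨l, hl, rfl⟩⟩ : valueGroup w) ^ j) fun i j hij ↦ ?_
  have := congrArg (fun g : valueGroup w ↦ ((g : Γˣ) : Γ)) hij
  exact zpow_right_injective₀ hwl hlt.ne (by simpa using this)

/-- The quotient of the value groups is cyclic, so its order is its exponent, and the m-th power of
the value of l lies in the value group of K. -/
theorem ramificationIndex_dvd (hl : l ≠ 0) (h : ∀ x : L, x ≠ 0 → ∃ j : ℤ, w x = w l ^ j)
    {m : ℕ} {z : K} (hm : l ^ m = algebraMap K L z) : ramificationIndex K w ∣ m := by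
  have : IsCyclic (valueGroup w) := ⟨_, mem_zpowers_of_val_eq_zpow hl h⟩
  have hcyc : IsCyclic (valueGroup w ⧸
      (valueGroup (w.comap (algebraMap K L))).subgroupOf (valueGroup w)) :=
    isCyclic_of_surjective (QuotientGroup.mk' _) (QuotientGroup.mk'_surjective _)
  change Nat.card (valueGroup w ⧸
      (valueGroup (w.comap (algebraMap K L))).subgroupOf (valueGroup w)) ∣ m
  rw [← IsCyclic.exponent_eq_card]
  refine Monoid.exponent_dvd_of_forall_pow_eq_one fun g ↦ ?_
  obtain ⟨g, rfl⟩ := QuotientGroup.mk_surjective g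
  rw [← QuotientGroup.mk_pow, QuotientGroup.eq_one_iff, Subgroup.mem_subgroupOf]
  obtain ⟨j, rfl⟩ := mem_zpowers_of_val_eq_zpow hl h g
  have hz : z ≠ 0 := by
    rintro rfl
    rw [map_zero] at hm
    exact pow_ne_zero m hl hm
  refine mem_valueGroup_iff.2 ⟨z ^ j, zpow_ne_zero j hz, ?_⟩
  rw [Valuation.comap_apply, map_zpow₀, map_zpow₀, ← hm, map_pow]
  simp only [Subgroup.coe_pow, Subgroup.coe_zpow, Units.val_pow_eq_pow_val, Units.val_zpow_eq_zpow_val,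
    Units.val_mk0]
  rw [← zpow_natCast, ← zpow_natCast, ← zpow_mul, ← zpow_mul, mul_comm]

end Radical
end Tame
-- The Galois action on the residue field
section ResidueAction

theorem continuous_of_isOpen_fixing {k F G : Type*} [Field k] [Field F] [Algebra k F] [Group G]
    [TopologicalSpace G] [IsTopologicalGroup G] (φ : G →* Gal(F/k))
    (h : ∀ t : F, IsOpen {g : G | φ g t = t}) : Continuous φ := by
  refine continuous_of_continuousAt_one φ ?_
  rw [ContinuousAt, map_one]
  intro U hU
  rw [krullTopology_mem_nhds_one_iff] at hU
  obtain ⟨E, hE, hEU⟩ := hU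
  obtain ⟨S, hS⟩ := IntermediateField.essFiniteType_iff.1 (inferInstance : Algebra.EssFiniteType k E)
  have h1 : (⋂ t ∈ S, {g : G | φ g t = t}) ∈ nhds (1 : G) := by
    refine (Filter.biInter_finset_mem S).2 fun t _ ↦ (h t).mem_nhds ?_
    simp
  refine Filter.mem_map.2 (Filter.mem_of_superset h1 fun g hg ↦ hEU ?_)
  have h2 : E ≤ IntermediateField.fixedField (Subgroup.zpowers (φ g)) := by
    rw [← hS, IntermediateField.adjoin_le_iff]
    intro t ht
    rw [SetLike.mem_coe, IntermediateField.mem_fixedField_iff]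
    have h3 : φ g • t = t := Set.mem_iInter₂.1 hg t ht
    intro τ hτ
    exact (Subgroup.zpowers_le.2 (MulAction.mem_stabilizer_iff.2 h3)) hτ
  rw [SetLike.mem_coe, IntermediateField.mem_fixingSubgroup_iff]
  intro x hx
  exact (IntermediateField.mem_fixedField_iff _ _).1 (h2 hx) _ (Subgroup.mem_zpowers _)

theorem exists_algebraMap_eq_of_pow_card_eq {k F : Type*} [Field k] [Field F] [Algebra k F]
    [Finite k] {t : F} (ht : t ^ Nat.card k = t) : ∃ a : k, algebraMap k F a = t := by
  have := Fintype.ofFinite k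
  rw [Nat.card_eq_fintype_card] at ht
  have h0 := FiniteField.X_pow_card_sub_X_ne_zero k (Fintype.one_lt_card (α := k))
  have hsp : (Polynomial.X ^ Fintype.card k - Polynomial.X : Polynomial k).Splits := by
    rw [Polynomial.splits_iff_card_roots, FiniteField.roots_X_pow_card_sub_X,
      FiniteField.X_pow_card_sub_X_natDegree_eq k Fintype.one_lt_card]
    rfl
  exact hsp.mem_range_of_isRoot h0 (by simp [ht])

variable {K L Γ₀ Γ : Type*} [Field K] [Field L] [Algebra K L] [LinearOrderedCommGroupWithZero Γ₀]
  [LinearOrderedCommGroupWithZero Γ] (v : Valuation K Γ₀) (w : Valuation L Γ) [v.HasExtension w]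

theorem isLocalHom_integerMap (hw : ∀ (σ : Gal(L/K)) (x : L), w (σ x) = w x) (σ : Gal(L/K)) :
    IsLocalHom (integerMap w hw σ) := by
  refine ⟨fun b hb ↦ ?_⟩
  by_contra hb'
  rw [← mem_nonunits_iff, ← IsLocalRing.mem_maximalIdeal, Valuation.mem_maximalIdeal_iff] at hb'
  have : integerMap w hw σ b ∈ IsLocalRing.maximalIdeal w.valuationSubring := by
    rw [Valuation.mem_maximalIdeal_iff]
    exact (hw σ b).trans_lt hb'
  exact this hb

/-- The action of the Galois group on the residue field. -/
noncomputable def residueAut (hw : ∀ (σ : Gal(L/K)) (x : L), w (σ x) = w x) :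
    Gal(L/K) →* Gal(IsLocalRing.ResidueField w.valuationSubring/Residue v) :=
  (AlgEquiv.algHomUnitsEquiv _ _).toMonoidHom.comp <| MonoidHom.toHomUnits
    { toFun σ :=
        { toRingHom :=
            have := isLocalHom_integerMap w hw σ
            IsLocalRing.ResidueField.map (integerMap w hw σ)
          commutes' r := by
            obtain ⟨a, rfl⟩ := IsLocalRing.residue_surjective r
            have := isLocalHom_integerMap w hw σ
            change IsLocalRing.ResidueField.map (integerMap w hw σ)
              (IsLocalRing.residue _ (algebraMap v.valuationSubring w.valuationSubring a)) =
              IsLocalRing.residue _ (algebraMap v.valuationSubring w.valuationSubring a)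
            rw [IsLocalRing.ResidueField.map_residue]
            congr 1
            exact Subtype.ext (σ.commutes a) }
      map_one' := by
        ext t
        obtain ⟨b, rfl⟩ := IsLocalRing.residue_surjective t
        rfl
      map_mul' σ τ := by
        ext t
        obtain ⟨b, rfl⟩ := IsLocalRing.residue_surjective t
        rfl }

theorem residueAut_residue (hw : ∀ (σ : Gal(L/K)) (x : L), w (σ x) = w x) (σ : Gal(L/K))
    (b : w.valuationSubring) : residueAut v w hw σ (IsLocalRing.residue _ b) =
      IsLocalRing.residue _ (integerMap w hw σ b) := rfl

theorem residueAut_eq_one_iff (hw : ∀ (σ : Gal(L/K)) (x : L), w (σ x) = w x) (σ : Gal(L/K)) :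
    residueAut v w hw σ = 1 ↔ σ ∈ inertia K w := by
  constructor
  · intro h
    refine ⟨hw σ, fun x hx ↦ ?_⟩
    exact (residue_eq_iff (integerMap w hw σ ⟨x, hx⟩) ⟨x, hx⟩).1
      (DFunLike.congr_fun h (IsLocalRing.residue _ ⟨x, hx⟩))
  · intro h
    ext t
    obtain ⟨b, rfl⟩ := IsLocalRing.residue_surjective t
    rw [residueAut_residue]
    exact (residue_eq_iff _ _).2 (h.2 b b.2)

theorem isOpen_setOf_residueAut_apply_eq [Algebra.IsAlgebraic K L]
    (hw : ∀ (σ : Gal(L/K)) (x : L), w (σ x) = w x)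
    (t : IsLocalRing.ResidueField w.valuationSubring) :
    IsOpen {σ : Gal(L/K) | residueAut v w hw σ t = t} := by
  obtain ⟨b, rfl⟩ := IsLocalRing.residue_surjective t
  have h : {σ : Gal(L/K) | residueAut v w hw σ (IsLocalRing.residue _ b) = IsLocalRing.residue _ b} =
      ⋃ c ∈ {c : L | w (c - b) < 1}, {σ : Gal(L/K) | σ (b : L) = c} := by
    ext σ
    rw [Set.mem_ofPred_eq, residueAut_residue, residue_eq_iff]
    simp [integerMap]
  rw [h]
  exact isOpen_biUnion fun c _ ↦ isOpen_setOf_apply_eq _ _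

variable {v w}

theorem isPrimitiveRoot_residue {π : K} {p f : ℕ} (H : IsLocalBase w π p f) {n : ℕ} (hn : n ≠ 0)
    {ζ : L} (hζ : IsPrimitiveRoot ζ (p ^ n - 1)) :
    ∃ z : IsLocalRing.ResidueField w.valuationSubring, IsPrimitiveRoot z (p ^ n - 1) := by
  have h0 := H.card_units_ne hn
  have hwζ : w ζ = 1 := by
    have := congrArg w hζ.pow_eq_one
    rw [map_pow, map_one] at this
    exact (pow_eq_one_iff_of_nonneg zero_le h0).1 this
  let Z : w.valuationSubring := ⟨ζ, hwζ.le⟩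
  refine ⟨IsLocalRing.residue _ Z, ⟨?_, fun i hi ↦ ?_⟩⟩
  · rw [← map_pow, ← map_one (IsLocalRing.residue w.valuationSubring)]
    exact congrArg _ (Subtype.ext hζ.pow_eq_one)
  · rw [← map_pow, ← map_one (IsLocalRing.residue w.valuationSubring), residue_eq_iff] at hi
    refine hζ.dvd_of_pow_eq_one i
      (apply_eq_of_pow_eq_one (H.val_card_units hn) h0 (one_pow _) ?_ hi)
    rw [← pow_mul, mul_comm, pow_mul, hζ.pow_eq_one, one_pow]

theorem IsLocalBase.isAlgebraic_residueField [Algebra.IsAlgebraic K L] {π : K} {p f : ℕ}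
    (H : IsLocalBase w π p f) :
    Algebra.IsAlgebraic (Residue v) (IsLocalRing.ResidueField w.valuationSubring) := by
  refine ⟨fun t ↦ ?_⟩
  obtain ⟨M, hM, h⟩ := H.exists_pow_eq t
  refine ⟨Polynomial.X ^ (p ^ f) ^ M - Polynomial.X,
    FiniteField.X_pow_card_sub_X_ne_zero _ ?_, by simp [h]⟩
  exact Nat.one_lt_pow hM.ne' (Nat.one_lt_pow H.f_ne H.prime.one_lt)

/-- A nonzero x algebraic over F generates over k a finite field of p ^ n elements, so it is a (p ^
n - 1)-th root of unity, hence a power of a primitive one already in F. -/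
theorem isSepClosure_of_isPrimitiveRoot {k F : Type*} [Field k] [Field F] [Algebra k F] [Finite k]
    [Algebra.IsAlgebraic k F] {p : ℕ} [Fact p.Prime] [CharP k p]
    (h : ∀ n ≠ 0, ∃ z : F, IsPrimitiveRoot z (p ^ n - 1)) : IsSepClosure k F := by
  have hsep : Algebra.IsSeparable k F := Algebra.IsAlgebraic.isSeparable_of_perfectField
  have hclosed : IsAlgClosed F := by
    refine IsAlgClosed.of_exists_root F fun g _ hg ↦ ?_
    obtain ⟨x, hx⟩ := IsAlgClosed.exists_aeval_eq_zero (AlgebraicClosure F) g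
      (Polynomial.degree_pos_of_irreducible hg).ne'
    have halg : IsIntegral k x :=
      (Algebra.IsAlgebraic.trans k F (AlgebraicClosure F)).isIntegral.isIntegral x
    have : FiniteDimensional k (IntermediateField.adjoin k {x}) :=
      IntermediateField.adjoin.finiteDimensional halg
    have : Finite (IntermediateField.adjoin k {x}) := Module.finite_of_finite k
    have := Fintype.ofFinite (IntermediateField.adjoin k {x})
    have : CharP (IntermediateField.adjoin k {x}) p :=
      charP_of_injective_algebraMap (algebraMap k _).injective p
    obtain ⟨n, -, hn⟩ := FiniteField.card (IntermediateField.adjoin k {x}) p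
    obtain ⟨z, hz⟩ := h n n.ne_zero
    obtain ⟨y, rfl⟩ : ∃ y : F, algebraMap F (AlgebraicClosure F) y = x := by
      by_cases hx0 : x = 0
      · exact ⟨0, by rw [hx0, map_zero]⟩
      have h1 := FiniteField.pow_card_sub_one_eq_one
        (⟨x, IntermediateField.mem_adjoin_simple_self k x⟩ : IntermediateField.adjoin k {x})
        (fun h ↦ hx0 (congrArg Subtype.val h))
      rw [hn] at h1
      have h2 : x ^ (p ^ (n : ℕ) - 1) = 1 := congrArg Subtype.val h1
      have hz' := hz.map_of_injective (algebraMap F (AlgebraicClosure F)).injective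
      have : NeZero (p ^ (n : ℕ) - 1) :=
        ⟨Nat.sub_ne_zero_of_lt (Nat.one_lt_pow n.ne_zero (Fact.out : p.Prime).one_lt)⟩
      obtain ⟨i, -, hi⟩ := hz'.eq_pow_of_pow_eq_one h2
      exact ⟨z ^ i, by rw [map_pow, hi]⟩
    refine ⟨y, ?_⟩
    rw [Polynomial.aeval_algebraMap_apply, map_eq_zero] at hx
    simpa using hx
  exact ⟨inferInstance, hsep⟩

end ResidueAction

/-! ### The totally ramified Kummer extension -/

section Kummer

variable {K L Γ : Type*} [Field K] [Field L] [Algebra K L] [LinearOrderedCommGroupWithZero Γ]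
  {w : Valuation L Γ} {π : K} {p f : ℕ} {l : L}

theorem IsLocalBase.kummer [FiniteDimensional K L] (H : IsLocalBase w π p f)
    {ζ : K} (hζ : IsPrimitiveRoot ζ (p ^ f - 1)) (hl : l ^ (p ^ f - 1) = algebraMap K L π)
    (htop : IntermediateField.adjoin K {l} = ⊤) :
    IsGalois K L ∧ IsCyclic Gal(L/K) ∧ Nat.card Gal(L/K) = p ^ f - 1 := by
  have h0 := H.card_units_ne H.f_ne
  have : NeZero (p ^ f - 1) := ⟨h0⟩
  have hζ' : (primitiveRoots (p ^ f - 1) K).Nonempty :=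
    ⟨ζ, (mem_primitiveRoots (Nat.pos_of_ne_zero h0)).2 hζ⟩
  have hsp : Polynomial.IsSplittingField K L (Polynomial.X ^ (p ^ f - 1) - Polynomial.C π) :=
    ⟨by
      have := X_pow_sub_C_splits_of_isPrimitiveRoot
        (hζ.map_of_injective (algebraMap K L).injective) hl
      simpa using this, by
      rw [← top_le_iff, ← IntermediateField.top_toSubalgebra, ← htop,
        IntermediateField.adjoin_simple_toSubalgebra_of_isAlgebraic (Algebra.IsAlgebraic.isAlgebraic l)]
      refine Algebra.adjoin_mono ?_
      rw [Set.singleton_subset_iff,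
        Polynomial.mem_rootSet_of_ne (Polynomial.X_pow_sub_C_ne_zero (Nat.pos_of_ne_zero h0) π)]
      simp [hl]⟩
  have hne : ((p ^ f - 1 : ℕ) : K) ≠ 0 := by
    intro h
    have h1 := H.val_card_units H.f_ne
    rw [← map_natCast (algebraMap K L), h, map_zero, map_zero] at h1
    exact zero_ne_one h1
  have hgal : IsGalois K L := IsGalois.of_separable_splitting_field
    (Polynomial.separable_X_pow_sub_C π hne H.pi_ne)
  have hirr := H.irreducible h0 hl htop
  refine ⟨hgal, isCyclic_of_isSplittingField_X_pow_sub_C hζ' hirr L, ?_⟩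
  rw [IsGalois.card_aut_eq_finrank, finrank_of_isSplittingField_X_pow_sub_C hζ' hirr L]

theorem IsLocalBase.not_dvd_ramificationIndex_of_radical [FiniteDimensional K L]
    (H : IsLocalBase w π p f)
    {ζ : K} (hζ : IsPrimitiveRoot ζ (p ^ f - 1)) (hl : l ^ (p ^ f - 1) = algebraMap K L π)
    (htop : IntermediateField.adjoin K {l} = ⊤) : ¬ p ∣ ramificationIndex K w := by
  obtain ⟨hgal, -, hcard⟩ := H.kummer hζ hl htop
  have h0 := H.card_units_ne H.f_ne
  have hl0 : l ≠ 0 := by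
    rintro rfl
    rw [zero_pow h0] at hl
    exact H.pi_ne ((map_eq_zero _).1 hl.symm)
  refine fun h ↦ H.not_dvd_pow_sub_one H.f_ne (h.trans (ramificationIndex_dvd hl0 (fun x hx ↦ ?_) hl))
  obtain ⟨z, hz⟩ := H.exists_val_eq_pow (fun σ _ ↦ by rw [← hcard, pow_card_eq_one']) hx
  exact H.exists_val_eq_zpow h0 hl hx hz

end Kummer
-- The Galois group as a product
section Structure

theorem adjoin_gen_eq_top {K L : Type*} [Field K] [Field L] [Algebra K L] (l : L) :
    IntermediateField.adjoin K {IntermediateField.AdjoinSimple.gen K l} = ⊤ := by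
  apply IntermediateField.map_injective (IntermediateField.adjoin K {l}).val
  rw [IntermediateField.adjoin_map, ← AlgHom.fieldRange_eq_map, IntermediateField.fieldRange_val,
    Set.image_singleton]
  rfl

variable {K T Γ₀ Γ : Type*} [Field K] [Field T] [Algebra K T] [LinearOrderedCommGroupWithZero Γ₀]
  [LinearOrderedCommGroupWithZero Γ] {v : Valuation K Γ₀} {w : Valuation T Γ} {π : K} {p f : ℕ}

theorem IsLocalBase.comap [IsGalois K T] (H : IsLocalBase w π p f) (E : IntermediateField K T)
    [Normal K E] : IsLocalBase (w.comap (algebraMap E T)) π p f where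
  prime := H.prime
  f_ne := H.f_ne
  val_p := by simpa using H.val_p
  pow_q x hx := by simpa using H.pow_q x hx
  pi_ne := H.pi_ne
  pi_lt := H.pi_lt
  gen := H.gen
  inv σ x := by
    obtain ⟨τ, rfl⟩ := AlgEquiv.restrictNormalHom_surjective T σ
    exact (congrArg w (AlgEquiv.restrictNormal_commutes τ E x)).trans (H.inv τ x)

/-- Tameness enters only through `hinj`: an inertia element is determined by its action on l. The
roots of unity make the residue field separably closed, and l supplies the factor of units. -/
theorem nonempty_continuousMulEquiv [IsAbelianGalois K T] [v.HasExtension w]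
    (H : IsLocalBase w π p f) [Finite (Residue v)] [CharP (Residue v) p]
    (hcard : Nat.card (Residue v) = p ^ f)
    (hroots : ∀ n ≠ 0, ∃ ζ : T, IsPrimitiveRoot ζ (p ^ n - 1))
    {ζ : K} (hζ : IsPrimitiveRoot ζ (p ^ f - 1)) {l : T} (hl : l ^ (p ^ f - 1) = algebraMap K T π)
    (hinj : ∀ σ ∈ inertia K w, σ l = l → σ = 1)
    [TopologicalSpace (Residue v)ˣ] [DiscreteTopology (Residue v)ˣ] :
    Nonempty (Gal(T/K) ≃ₜ* Gal(SeparableClosure (Residue v)/Residue v) × (Residue v)ˣ) := by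
  have hp := Fact.mk H.prime
  have halg : Algebra.IsAlgebraic (Residue v) (IsLocalRing.ResidueField w.valuationSubring) :=
    H.isAlgebraic_residueField
  have hsc : IsSepClosure (Residue v) (IsLocalRing.ResidueField w.valuationSubring) :=
    isSepClosure_of_isPrimitiveRoot (p := p) fun n hn ↦
      let ⟨_, hz⟩ := hroots n hn
      isPrimitiveRoot_residue H hn hz
  let e : IsLocalRing.ResidueField w.valuationSubring ≃ₐ[Residue v]
    SeparableClosure (Residue v) := IsSepClosure.equiv _ _ _
  let ρ := residueAut v w H.inv
  let ψ₁ : Gal(T/K) →* Gal(SeparableClosure (Residue v)/Residue v) :=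
    (AlgEquiv.autCongr e).toMonoidHom.comp ρ
  have hψ₁c : Continuous ψ₁ := continuous_of_isOpen_fixing ψ₁ fun t ↦ by
    have h : {σ | ψ₁ σ t = t} = {σ | residueAut v w H.inv σ (e.symm t) = e.symm t} :=
      Set.ext fun σ ↦ (AlgEquiv.eq_symm_apply e).symm
    rw [h]
    exact isOpen_setOf_residueAut_apply_eq v w H.inv (e.symm t)
  let E := IntermediateField.adjoin K {l}
  have : FiniteDimensional K E :=
    IntermediateField.adjoin.finiteDimensional (Algebra.IsIntegral.isIntegral l)
  have HE := H.comap E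
  have hlE : (IntermediateField.AdjoinSimple.gen K l) ^ (p ^ f - 1) = algebraMap K E π :=
    Subtype.ext hl
  have htop := adjoin_gen_eq_top (K := K) l
  obtain ⟨-, hcyc, hcardE⟩ := HE.kummer hζ hlE htop
  have hIE := HE.inertia_eq_top hlE htop hcardE
  have hcyc' : IsCyclic (Residue v)ˣ := inferInstance
  -- Any isomorphism between these cyclic groups of order q - 1 serves.
  let c : Gal(E/K) ≃* (Residue v)ˣ := mulEquivOfCyclicCardEq (by
    rw [hcardE, Nat.card_units, hcard])
  let ψ₂ : Gal(T/K) →* (Residue v)ˣ := c.toMonoidHom.comp (AlgEquiv.restrictNormalHom E)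
  have hψ₂c : Continuous ψ₂ := (continuous_of_discreteTopology (f := c)).comp
    (InfiniteGalois.restrictNormalHom_continuous E)
  let ψ := ψ₁.prod ψ₂
  have hinjψ : Function.Injective ψ := by
    rw [injective_iff_map_eq_one]
    intro σ hσ
    obtain ⟨h1, h2⟩ := Prod.ext_iff.1 hσ
    refine hinj σ ?_ ?_
    · rw [← residueAut_eq_one_iff v w H.inv]
      exact (AlgEquiv.autCongr e).map_eq_one_iff.1 h1
    · have h3 : AlgEquiv.restrictNormalHom E σ = 1 := c.map_eq_one_iff.1 h2
      have h4 := AlgEquiv.restrictNormal_commutes σ E (IntermediateField.AdjoinSimple.gen K l)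
      change algebraMap E T ((AlgEquiv.restrictNormalHom E σ) _) = _ at h4
      rw [h3] at h4
      exact h4.symm
  have hsurjψ : Function.Surjective ψ := by
    rintro ⟨τ, u⟩
    obtain ⟨σ₀, hσ₀⟩ := AlgEquiv.restrictNormalHom_surjective T (c.symm u)
    -- σ₀ has the right restriction to E; the error τ' on residues is corrected by an automorphism
    -- fixing E. It lifts because E is totally ramified: integers of E have residues in k.
    let τ' : Gal(IsLocalRing.ResidueField w.valuationSubring/Residue v) :=
      (AlgEquiv.autCongr e).symm τ * (ρ σ₀)⁻¹
    obtain ⟨σ₁, hσ₁, h⟩ := exists_lift_residueField H.inv E.fixingSubgroup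
      (InfiniteGalois.fixingSubgroup_isClosed E) τ'.toRingEquiv fun b hb ↦ by
        have hbE : (b : T) ∈ E := by
          rw [← InfiniteGalois.fixedField_fixingSubgroup E, IntermediateField.mem_fixedField_iff]
          exact hb
        obtain ⟨z, hz⟩ := exists_val_sub_lt_one (w := w.comap (algebraMap E T)) (x := ⟨b, hbE⟩)
          (by rw [hcardE]; exact HE.val_card_units HE.f_ne) hIE b.2
        have hz' : w ((b : T) - algebraMap K T z) < 1 := hz
        have hzw : w (algebraMap K T z) ≤ 1 := by
          have := w.map_sub b.1 (b.1 - algebraMap K T z)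
          rw [sub_sub_cancel] at this
          exact this.trans (max_le b.2 hz'.le)
        let Z : v.valuationSubring := ⟨z, (Valuation.HasExtension.val_map_le_one_iff v w z).1 hzw⟩
        have hbZ : IsLocalRing.residue _ b =
            algebraMap (Residue v) _ (IsLocalRing.residue _ Z) :=
          (residue_eq_iff b (algebraMap v.valuationSubring w.valuationSubring Z)).2 hz'
        rw [hbZ]
        exact τ'.commutes _
    have hρ : ρ σ₁ = τ' := by
      ext t
      obtain ⟨b, rfl⟩ := IsLocalRing.residue_surjective t
      exact h b
    refine ⟨σ₁ * σ₀, Prod.ext ?_ ?_⟩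
    · change AlgEquiv.autCongr e (ρ (σ₁ * σ₀)) = τ
      rw [map_mul, hρ, inv_mul_cancel_right, MulEquiv.apply_symm_apply]
    · change c (AlgEquiv.restrictNormalHom E (σ₁ * σ₀)) = u
      have h1 : AlgEquiv.restrictNormalHom E σ₁ = 1 := by
        ext x
        have h2 := AlgEquiv.restrictNormal_commutes σ₁ E x
        exact h2.trans ((IntermediateField.mem_fixingSubgroup_iff _ _).1 hσ₁ x x.2)
      rw [map_mul, h1, one_mul, hσ₀, MulEquiv.apply_symm_apply]
  have hcont : Continuous ψ := hψ₁c.prodMk hψ₂c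
  have : T2Space Gal(SeparableClosure (Residue v)/Residue v) := krullTopology_t2
  -- A continuous bijection from a compact space to a Hausdorff space is a homeomorphism.
  let Ψ := MulEquiv.ofBijective ψ ⟨hinjψ, hsurjψ⟩
  exact ⟨{ Ψ with
    continuous_toFun := hcont
    continuous_invFun := (Continuous.homeoOfEquivCompactToT2 (f := Ψ.toEquiv) hcont).symm.continuous }⟩

end Structure
-- Values and elements of the tame abelian compositum
section Compositum

variable {K : Type u} [Field K] {Γ₀ : Type v} [LinearOrderedCommGroupWithZero Γ₀]
  {v : Valuation K Γ₀}

theorem hasExtension_comap {L Ω Γ : Type*} [Field L] [Field Ω] [Algebra K L] [Algebra K Ω]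
    [Algebra L Ω] [IsScalarTower K L Ω] [LinearOrderedCommGroupWithZero Γ] (w : Valuation Ω Γ)
    [v.HasExtension w] : v.HasExtension (w.comap (algebraMap L Ω)) := ⟨by
  have h := Valuation.HasExtension.val_isEquiv_comap (vR := v) (vA := w)
  rwa [IsScalarTower.algebraMap_eq K L Ω] at h⟩

theorem eq_of_forall_apply_eq {Ω : Type*} [Field Ω] [Algebra K Ω] (S : Set (IntermediateField K Ω))
    (τ : Gal(Ω/K)) (h : ∀ L ∈ S, ∀ x ∈ L, τ x = x) {x : Ω} (hx : x ∈ sSup S) : τ x = x := by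
  have hle : sSup S ≤ IntermediateField.fixedField (Subgroup.zpowers τ) := by
    refine sSup_le fun L hL y hy ↦ ?_
    rw [IntermediateField.mem_fixedField_iff]
    intro ρ hρ
    exact (Subgroup.zpowers_le.2 (MulAction.mem_stabilizer_iff.2 (show τ • y = y from h L hL y hy))) hρ
  exact (IntermediateField.mem_fixedField_iff _ _).1 (hle hx) _ (Subgroup.mem_zpowers _)

theorem isAbelianGalois_of_le_maxAbelianExtension {L : IntermediateField K (SeparableClosure K)}
    (hL : L ≤ maxAbelianExtension K) : IsAbelianGalois K L := by
  have : IsAbelianGalois K (maxAbelianExtension K) := isAbelianGalois_sSup _ fun _ h ↦ h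
  exact IsAbelianGalois.of_algHom (IntermediateField.inclusion hL)

theorem le_maxAbelianExtension (L : IntermediateField K (SeparableClosure K))
    [IsAbelianGalois K L] : L ≤ maxAbelianExtension K :=
  le_sSup ‹_›

instance isAbelianGalois_tameAbelianCompositum : IsAbelianGalois K (tameAbelianCompositum v) :=
  isAbelianGalois_sSup _ fun _ h ↦ isAbelianGalois_of_le_maxAbelianExtension h.1

theorem mem_tameAbelianCompositum {x : SeparableClosure K}
    (h : IsAbelianGalois K (IntermediateField.adjoin K {x}))
    (ht : IsTamelyRamified v (IntermediateField.adjoin K {x})) : x ∈ tameAbelianCompositum v :=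
  (le_sSup ⟨le_maxAbelianExtension _,
    IntermediateField.adjoin.finiteDimensional (Algebra.IsIntegral.isIntegral x), ht⟩ :
    IntermediateField.adjoin K {x} ≤ tameAbelianCompositum v)
    (IntermediateField.mem_adjoin_simple_self K x)

variable (hv : IsHenselian v) {π : K} {f : ℕ} (H : IsLocalBase v π (ringChar (Residue v)) f)
  {Γ : Type u} [LinearOrderedCommGroupWithZero Γ] (w : Valuation (SeparableClosure K) Γ)
  [v.HasExtension w]

include hv H in
theorem apply_eq_of_tame {L : IntermediateField K (SeparableClosure K)}
    (hL : L ≤ maxAbelianExtension K) [FiniteDimensional K L] (ht : IsTamelyRamified v L)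
    (τ : Gal(SeparableClosure K/K)) (h : ∀ x ∈ L, x ≠ 0 → w (τ x - x) < w x) {x}
    (hx : x ∈ L) : τ x = x := by
  have := isAbelianGalois_of_le_maxAbelianExtension hL
  have hext : v.HasExtension (w.comap (algebraMap L (SeparableClosure K))) := hasExtension_comap w
  have HL := hv.isLocalBase H (w.comap (algebraMap L (SeparableClosure K)))
  have hmem : AlgEquiv.restrictNormalHom L τ ∈
      wildInertia K (w.comap (algebraMap L (SeparableClosure K))) := by
    refine ⟨HL.inv _, fun y hy ↦ ?_⟩
    rw [Valuation.comap_apply, Valuation.comap_apply, map_sub]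
    have h1 := AlgEquiv.restrictNormal_commutes τ L y
    change algebraMap L _ (AlgEquiv.restrictNormalHom L τ y) = _ at h1
    rw [h1]
    exact h y y.2 (by simpa using hy)
  rw [HL.wildInertia_eq_bot (ht _ _ hext), Subgroup.mem_bot] at hmem
  have h1 := AlgEquiv.restrictNormal_commutes τ L ⟨x, hx⟩
  change algebraMap L _ (AlgEquiv.restrictNormalHom L τ _) = _ at h1
  rw [hmem] at h1
  exact h1.symm

include hv H in
theorem pow_apply_eq_of_tame {L : IntermediateField K (SeparableClosure K)}
    (hL : L ≤ maxAbelianExtension K) [FiniteDimensional K L] (ht : IsTamelyRamified v L)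
    (τ : Gal(SeparableClosure K/K)) (h : ∀ x ∈ L, w x ≤ 1 → w (τ x - x) < 1) {x}
    (hx : x ∈ L) : (τ ^ (ringChar (Residue v) ^ f - 1)) x = x := by
  have := isAbelianGalois_of_le_maxAbelianExtension hL
  have hext : v.HasExtension (w.comap (algebraMap L (SeparableClosure K))) := hasExtension_comap w
  have HL := hv.isLocalBase H (w.comap (algebraMap L (SeparableClosure K)))
  have hmem : AlgEquiv.restrictNormalHom L τ ∈
      inertia K (w.comap (algebraMap L (SeparableClosure K))) := by
    refine ⟨HL.inv _, fun y hy ↦ ?_⟩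
    rw [Valuation.comap_apply, map_sub]
    have h1 := AlgEquiv.restrictNormal_commutes τ L y
    change algebraMap L _ (AlgEquiv.restrictNormalHom L τ y) = _ at h1
    rw [h1]
    exact h y y.2 hy
  have hpow := HL.pow_eq_one_of_mem_inertia (ht _ _ hext) hmem
  rw [← map_pow] at hpow
  have h1 := AlgEquiv.restrictNormal_commutes (τ ^ (ringChar (Residue v) ^ f - 1)) L ⟨x, hx⟩
  change algebraMap L _ (AlgEquiv.restrictNormalHom L _ _) = _ at h1
  rw [hpow] at h1
  exact h1.symm

include hv H in
-- x lies in a compositum L of finitely many tame pieces. Tameness of L itself is not needed: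
-- inertia of L restricts to inertia of each piece, so its (q - 1)-th powers are trivial on every
-- piece and hence on L.
theorem exists_val_eq_pow_of_mem_tameAbelianCompositum {x : SeparableClosure K}
    (hx : x ∈ tameAbelianCompositum v) (hx0 : x ≠ 0) :
    ∃ z : K, w (algebraMap K _ z) = w x ^ (ringChar (Residue v) ^ f - 1) := by
  have hx' := hx
  rw [tameAbelianCompositum, sSup_eq_iSup'] at hx'
  obtain ⟨s, hs⟩ := IntermediateField.exists_finset_of_mem_iSup hx'
  set L : IntermediateField K (SeparableClosure K) := ⨆ i ∈ s, i.1 with hLdef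
  have : FiniteDimensional K L :=
    IntermediateField.finiteDimensional_iSup_of_finset' fun i _ ↦ i.2.2.1
  have hle : L ≤ maxAbelianExtension K := iSup₂_le fun i _ ↦ i.2.1
  have := isAbelianGalois_of_le_maxAbelianExtension hle
  have hext : v.HasExtension (w.comap (algebraMap L (SeparableClosure K))) := hasExtension_comap w
  have HL := hv.isLocalBase H (w.comap (algebraMap L (SeparableClosure K)))
  refine HL.exists_val_eq_pow (x := ⟨x, hs⟩) (fun σ hσ ↦ ?_)
    fun h ↦ hx0 (congrArg Subtype.val h)
  obtain ⟨τ, rfl⟩ := AlgEquiv.restrictNormalHom_surjective (SeparableClosure K) σ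
  rw [← map_pow]
  refine AlgEquiv.ext fun y ↦ Subtype.ext ?_
  refine (AlgEquiv.restrictNormal_commutes (τ ^ (ringChar (Residue v) ^ f - 1)) L y).trans ?_
  refine eq_of_forall_apply_eq ((fun i ↦ i.1) '' {i | i ∈ s}) _ ?_ (x := (y : SeparableClosure K)) ?_
  · rintro _ ⟨M, hM, rfl⟩ z hz
    have hML : M.1 ≤ L := le_iSup₂_of_le M hM le_rfl
    have := M.2.2.1
    refine pow_apply_eq_of_tame hv H w M.2.1 M.2.2.2 τ (fun a ha hwa ↦ ?_) hz
    have h1 := hσ.2 ⟨a, hML ha⟩ hwa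
    rw [Valuation.comap_apply, map_sub] at h1
    have h2 := AlgEquiv.restrictNormal_commutes τ L ⟨a, hML ha⟩
    change algebraMap L _ (AlgEquiv.restrictNormalHom L τ _) = _ at h2
    rw [h2] at h1
    exact h1
  · rw [sSup_image]
    exact y.2

include H in
theorem exists_isPrimitiveRoot (n : ℕ) (hn : n ≠ 0) :
    ∃ ζ : SeparableClosure K, IsPrimitiveRoot ζ (ringChar (Residue v) ^ n - 1) := by
  have : NeZero ((ringChar (Residue v) ^ n - 1 : ℕ) : K) := ⟨fun h ↦ by
    have h1 := H.val_card_units hn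
    rw [h, map_zero] at h1
    exact zero_ne_one h1⟩
  exact HasEnoughRootsOfUnity.exists_primitiveRoot _ _

include hv H in
theorem isPrimitiveRoot_mem_tameAbelianCompositum {n : ℕ} (hn : n ≠ 0) {ζ : SeparableClosure K}
    (hζ : IsPrimitiveRoot ζ (ringChar (Residue v) ^ n - 1)) : ζ ∈ tameAbelianCompositum v := by
  have : NeZero (ringChar (Residue v) ^ n - 1) := ⟨H.card_units_ne hn⟩
  have hcyc := hζ.intermediateField_adjoin_isCyclotomicExtension K
  have hab : IsAbelianGalois K (IntermediateField.adjoin K {ζ}) :=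
    IsCyclotomicExtension.isAbelianGalois {ringChar (Residue v) ^ n - 1} K _
  have : FiniteDimensional K (IntermediateField.adjoin K {ζ}) :=
    IntermediateField.adjoin.finiteDimensional (Algebra.IsIntegral.isIntegral ζ)
  refine mem_tameAbelianCompositum hab fun Γ _ w' hw' ↦ ?_
  rw [(hv.isLocalBase H w').ramificationIndex_eq_one_of_cyclotomic hn
    (Subtype.ext hζ.pow_eq_one) (adjoin_gen_eq_top ζ)]
  exact fun h ↦ H.prime.one_lt.ne' (Nat.dvd_one.1 h)

include hv H in
-- A primitive root ζ in the separable closure has residue in k, so it is congruent to some a in K.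
-- Every conjugate of ζ is congruent to a as well, hence equals ζ, and ζ lies in K.
theorem exists_isPrimitiveRoot_base [Finite (Residue v)]
    (hcard : Nat.card (Residue v) = ringChar (Residue v) ^ f) :
    ∃ ζ : K, IsPrimitiveRoot ζ (ringChar (Residue v) ^ f - 1) := by
  obtain ⟨Γ, _, w, hw⟩ := (hv (SeparableClosure K)).1
  have HΩ := hv.isLocalBase H w
  obtain ⟨ζ, hζ⟩ := exists_isPrimitiveRoot H f H.f_ne
  have h0 := H.card_units_ne H.f_ne
  have hwζ : w ζ = 1 := by
    have := congrArg w hζ.pow_eq_one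
    rw [map_pow, map_one] at this
    exact (pow_eq_one_iff_of_nonneg zero_le h0).1 this
  let Z : w.valuationSubring := ⟨ζ, hwζ.le⟩
  obtain ⟨a, ha⟩ := exists_algebraMap_eq_of_pow_card_eq (k := Residue v)
    (t := IsLocalRing.residue _ Z) (by
      rw [hcard, ← map_pow]
      congr 1
      refine Subtype.ext ?_
      change ζ ^ _ = ζ
      rw [← Nat.sub_add_cancel (Nat.one_le_pow f _ H.prime.pos), pow_succ, hζ.pow_eq_one, one_mul])
  obtain ⟨a, rfl⟩ := IsLocalRing.residue_surjective a
  have ha' : w (algebraMap K _ a - ζ) < 1 :=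
    (residue_eq_iff (algebraMap v.valuationSubring w.valuationSubring a) Z).1 ha
  obtain ⟨z, rfl⟩ := (InfiniteGalois.mem_range_algebraMap_iff_fixed (k := K) ζ).2 fun σ ↦ by
    refine apply_eq_of_pow_eq_one (HΩ.val_card_units H.f_ne) h0 hζ.pow_eq_one
      (by rw [← map_pow, hζ.pow_eq_one, map_one]) ?_
    have h1 : w (σ (algebraMap K _ a - ζ)) < 1 := by rwa [HΩ.inv]
    have h2 := w.map_sub_lt ha' h1
    rwa [map_sub σ, AlgEquiv.commutes, sub_sub_sub_cancel_left] at h2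
  exact ⟨z, hζ.of_map_of_injective (algebraMap K _).injective⟩

include hv H in
theorem radical_mem_tameAbelianCompositum {ζ : K}
    (hζ : IsPrimitiveRoot ζ (ringChar (Residue v) ^ f - 1)) {l : SeparableClosure K}
    (hl : l ^ (ringChar (Residue v) ^ f - 1) = algebraMap K _ π) : l ∈ tameAbelianCompositum v := by
  have : FiniteDimensional K (IntermediateField.adjoin K {l}) :=
    IntermediateField.adjoin.finiteDimensional (Algebra.IsIntegral.isIntegral l)
  have hl' : (IntermediateField.AdjoinSimple.gen K l) ^ (ringChar (Residue v) ^ f - 1) =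
    algebraMap K _ π := Subtype.ext hl
  obtain ⟨Γ, _, w, hw⟩ := (hv (IntermediateField.adjoin K {l})).1
  obtain ⟨hgal, hcyc, -⟩ := (hv.isLocalBase H w).kummer hζ hl' (adjoin_gen_eq_top l)
  refine mem_tameAbelianCompositum (.of_isCyclic _ _) fun Γ _ w' hw' ↦ ?_
  exact (hv.isLocalBase H w').not_dvd_ramificationIndex_of_radical hζ hl' (adjoin_gen_eq_top l)

end Compositum
end HDVField

open HDVField in
theorem proposition4p3 {K : Type u} [Field K] {Γ₀ : Type v} [LinearOrderedCommGroupWithZero Γ₀]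
    (v : Valuation K Γ₀) (hv : HDVField.IsHenselian v) (hd : HDVField.IsDiscrete v)
    (hk : Finite (HDVField.Residue v)) :
    IsGalois K (HDVField.tameAbelianCompositum v) ∧
    -- an isomorphism of topological groups, the finite group of units being discrete
    (∀ [TopologicalSpace (HDVField.Residue v)ˣ] [DiscreteTopology (HDVField.Residue v)ˣ],
      Nonempty (Gal(HDVField.tameAbelianCompositum v/K) ≃ₜ*
        Gal(SeparableClosure (HDVField.Residue v)/HDVField.Residue v) × (HDVField.Residue v)ˣ)) ∧
    -- the valuation of `T` extending `v` is discrete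
    (∀ {Γ : Type*} [LinearOrderedCommGroupWithZero Γ]
      (w : Valuation (HDVField.tameAbelianCompositum v) Γ),
      v.HasExtension w → HDVField.IsDiscrete w) := by
  obtain ⟨π, f, hcard, H⟩ := exists_isLocalBase hd hk
  obtain ⟨Γ, _, w, hw⟩ := (hv (SeparableClosure K)).1
  have hwT : v.HasExtension (w.comap (algebraMap (tameAbelianCompositum v) (SeparableClosure K))) :=
    hasExtension_comap w
  obtain ⟨ζ, hζ⟩ := exists_isPrimitiveRoot_base hv H hcard
  have h0 := H.card_units_ne H.f_ne
  obtain ⟨l, hl⟩ : ∃ l : SeparableClosure K,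
      l ^ (ringChar (Residue v) ^ f - 1) = algebraMap K _ π := by
    have : NeZero ((ringChar (Residue v) ^ f - 1 : ℕ) : SeparableClosure K) := ⟨fun h ↦ by
      have h1 := (hv.isLocalBase H w).val_card_units H.f_ne
      rw [h, map_zero] at h1
      exact zero_ne_one h1⟩
    exact IsSepClosed.exists_pow_nat_eq _ _
  have hl0 : l ≠ 0 := by
    rintro rfl
    rw [zero_pow h0] at hl
    exact H.pi_ne ((map_eq_zero _).1 hl.symm)
  let lT : tameAbelianCompositum v := ⟨l, radical_mem_tameAbelianCompositum hv H hζ hl⟩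
  have hlT : lT ^ (ringChar (Residue v) ^ f - 1) = algebraMap K _ π := Subtype.ext hl
  have hlT0 : lT ≠ 0 := fun h ↦ hl0 (congrArg Subtype.val h)
  -- The value of l generates the value group of T; both injectivity and discreteness rest on this.
  have hval {x : SeparableClosure K} (hx : x ∈ tameAbelianCompositum v) (hx0 : x ≠ 0) :
      ∃ j : ℤ, w x = w l ^ j := by
    obtain ⟨z, hz⟩ := exists_val_eq_pow_of_mem_tameAbelianCompositum hv H w hx hx0
    exact (hv.isLocalBase H w).exists_val_eq_zpow h0 hl hx0 hz
  refine ⟨inferInstance, fun {_ _} ↦ ?_, fun {Γ'} _ w' hw' ↦ ?_⟩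
  · have HT := hv.isLocalBase H
      (w.comap (algebraMap (tameAbelianCompositum v) (SeparableClosure K)))
    refine nonempty_continuousMulEquiv HT hcard (fun n hn ↦ ?_) hζ hlT fun σ hσ hσl ↦ ?_
    · obtain ⟨z, hz⟩ := exists_isPrimitiveRoot H n hn
      exact ⟨⟨z, isPrimitiveRoot_mem_tameAbelianCompositum hv H hn hz⟩,
        IsPrimitiveRoot.coe_submonoidClass_iff.1 hz⟩
    · obtain ⟨τ, rfl⟩ := AlgEquiv.restrictNormalHom_surjective (SeparableClosure K) σ
      have hcomm (y : tameAbelianCompositum v) :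
          ((AlgEquiv.restrictNormalHom (tameAbelianCompositum v) τ y : tameAbelianCompositum v) :
            SeparableClosure K) = τ y :=
        AlgEquiv.restrictNormal_commutes τ (tameAbelianCompositum v) y
      have hτl : τ l = l := (hcomm lT).symm.trans (congrArg Subtype.val hσl)
      refine AlgEquiv.ext fun x ↦ Subtype.ext ?_
      refine (hcomm x).trans (eq_of_forall_apply_eq _ τ (fun L hL y hy ↦ ?_) x.2)
      have := hL.2.1
      refine apply_eq_of_tame hv H w hL.1 hL.2.2 τ (fun a ha ha0 ↦ ?_) hy
      have haT : a ∈ tameAbelianCompositum v := (le_sSup hL : L ≤ tameAbelianCompositum v) ha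
      -- Write a as l ^ j times a unit: τ fixes l and moves the unit by less than 1, so it moves a
      -- by less than w a.
      obtain ⟨j, hj⟩ := hval haT ha0
      have hl0j : l ^ j ≠ 0 := zpow_ne_zero j hl0
      have hlj : w (l ^ j) ≠ 0 := (w.ne_zero_iff).2 hl0j
      have hu : w (a / l ^ j) = 1 := by
        rw [map_div₀, hj, ← map_zpow₀, div_self hlj]
      have huT : a / l ^ j ∈ tameAbelianCompositum v := div_mem haT (zpow_mem lT.2 j)
      have h1 : w (τ (a / l ^ j) - a / l ^ j) < 1 := by
        have := hσ.2 ⟨a / l ^ j, huT⟩ hu.le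
        rw [Valuation.comap_apply, map_sub] at this
        rwa [← hcomm ⟨a / l ^ j, huT⟩]
      have h2 : τ a - a = l ^ j * (τ (a / l ^ j) - a / l ^ j) := by
        rw [map_div₀, map_zpow₀, hτl]
        field_simp
      rw [h2, map_mul, hj, ← map_zpow₀]
      exact mul_lt_of_lt_one_right (zero_lt_iff.2 hlj) h1
  · have HT := hv.isLocalBase H w'
    refine isDiscrete_of_val_eq_zpow hlT0 ?_ fun x hx ↦ ?_
    · have := HT.pi_lt
      rw [← hlT, map_pow] at this
      exact (pow_lt_one_iff_of_nonneg zero_le h0).1 this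
    · obtain ⟨j, hj⟩ := hval x.2 (fun h ↦ hx (Subtype.ext h))
      refine ⟨j, ?_⟩
      -- By uniqueness, the generator found for the restriction of w serves for an arbitrary
      -- extension w'.
      have heq := hv.isEquiv (w.comap (algebraMap (tameAbelianCompositum v) (SeparableClosure K))) w'
      rw [← map_zpow₀, ← heq.eq_iff]
      simpa [lT] using hj
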